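/- Balls $B(x,r)$ are closed and $|\cdot|$ denotes diameter. A compact subset $A$ of a metric space is called homogeneous if $|A|>0$ and there is a Borel probability measure $\mu$ supported on $A$ such that, for some constants $\lambda\ge 1$, $\kappa\in(0,1)$ and $1<\delta\le\Delta<\infty$, $$\lambda^{-1}\le\frac{\mu(B(x_1,r))}{\mu(B(x_2,r))}\le\lambda,\qquad \delta\le\frac{\mu(B(x,r))}{\mu(B(x,\kappa r))}\le\Delta$$ for all $x,x_1,x_2\in A$ and $0<r\le|A|$. For such an $A$, $\alpha_A(r)$ denotes any function with $$\left|\alpha_A(r)-\frac{\log\mu(B(x,r))}{\log r}\right|=O(|\log r|^{-1})\quad(r\to0)$$ for some such $\mu$ and some $x\in A$. For homogeneous sets $A,B$ (possibly in different metric spaces) put $$\chi(A,B)=\limsup_{r\to0}\left|\log\frac{\alpha_A(r)}{\alpha_B(r)}\right|,$$ which does not depend on the choices made. Let $\mathrm d_H$ be the Hausdorff distance, and $\dim_H$, $\dim_P$ the Hausdorff and packing dimensions. A Moran set in $\mathbb R^d$ is a set $$E=\bigcap_{k\ge0}\ \bigcup_{i_1\cdots i_k,\ 1\le i_t\le n_t}J_{i_1\cdots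 i_k},$$ where $n_k\ge2$ are integers, $c_k\in(0,1)$ with $\inf_kc_k>0$, $J_\emptyset\subset\mathbb R^d$ is compact with non-empty interior, and for every word $i_1\cdots i_{k-1}$ ($k\ge1$) the sets $J_{i_1\cdots i_{k-1}1},\dots,J_{i_1\cdots i_{k-1}n_k}$ are contained in $J_{i_1\cdots i_{k-1}}$, are images of it under similitudes of ratio $c_k$, and have pairwise disjoint interiors. **Theorem.** (1) Let $A$ be a homogeneous set in a metric space. For every $\varepsilon>0$ there are a Moran set $E$ in some Euclidean space $\mathbb R^d$ and a bilipschitz map $f\colon E\to A$ (that is, $|x-y|/L\le \mathrm d(f(x),f(y))\le L|x-y|$ on $E$ for some $L\ge1$) such that $E$ and $f(E)$ are homogeneous, $$\mathrm d_H(f(E),A)<\varepsilon\quad\text{and}\quad\chi(E,A)=\chi(f(E),A)<\varepsilon.$$ (2) Let $A\subset\mathbb R^d$ be a homogeneous set. For every $\varepsilon>0$ there is a Moran set $F\subset A$ in $\mathbb R^d$ such that $$\mathrm d_H(F,A)<\varepsilon,\qquad 0\le\dim_PA-\dim_PF<\varepsilon,\qquad 0\le\dim_HA-\dim_HF<\varepsilon.$$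 -/

import Mathlib

open Set Filter Topology MeasureTheory Asymptotics
open scoped ENNReal NNReal

noncomputable section

namespace HomogeneousFractal

/-! Homogeneous sets -/

/-- `μ` is a Borel probability measure supported on `A` which satisfies the two conditions in the
definition of a homogeneous set; the balls are closed and `Metric.diam A` is `|A|`.  Since
`0 / 0 = 0` in `ℝ` and `1 < δ`, the lower bound in `ratio` forces all the measures of balls
occurring in the denominators to be positive. -/
structure IsHomogeneousMeasure {X : Type*} [MetricSpace X] [MeasurableSpace X]
    (μ : Measure X) (A : Set X) : Prop where
  prob : IsProbabilityMeasure μ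
  supported : μ Aᶜ = 0
  comparable : ∃ lam : ℝ, 1 ≤ lam ∧ ∀ x₁ ∈ A, ∀ x₂ ∈ A, ∀ r : ℝ, 0 < r → r ≤ Metric.diam A →
    lam⁻¹ ≤ μ.real (Metric.closedBall x₁ r) / μ.real (Metric.closedBall x₂ r) ∧
      μ.real (Metric.closedBall x₁ r) / μ.real (Metric.closedBall x₂ r) ≤ lam
  ratio : ∃ κ δ Δ : ℝ, 0 < κ ∧ κ < 1 ∧ 1 < δ ∧ δ ≤ Δ ∧
    ∀ x ∈ A, ∀ r : ℝ, 0 < r → r ≤ Metric.diam A →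
      δ ≤ μ.real (Metric.closedBall x r) / μ.real (Metric.closedBall x (κ * r)) ∧
        μ.real (Metric.closedBall x r) / μ.real (Metric.closedBall x (κ * r)) ≤ Δ

/-- A compact set of positive diameter carrying a measure as above. -/
def IsHomogeneous {X : Type*} [MetricSpace X] [MeasurableSpace X] (A : Set X) : Prop :=
  IsCompact A ∧ 0 < Metric.diam A ∧ ∃ μ : Measure X, IsHomogeneousMeasure μ A

/-- The function `r ↦ log μ(B(x,r)) / log r`. -/
def alphaAt {X : Type*} [MetricSpace X] [MeasurableSpace X]
    (μ : Measure X) (x : X) (r : ℝ) : ℝ :=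
  Real.log (μ.real (Metric.closedBall x r)) / Real.log r

/-- `h ∼ g` means `|h(r) - g(r)| = O(|log r|⁻¹)` as `r → 0+`. -/
def AlphaEquiv (h g : ℝ → ℝ) : Prop :=
  (fun r => h r - g r) =O[𝓝[>] (0 : ℝ)] fun r => |Real.log r|⁻¹

/-- The functions which may be denoted `α_A`: the members of the equivalence class of
`alphaAt μ x`, where `μ` is a measure showing that `A` is homogeneous and `x ∈ A`.  (For a
homogeneous set all these classes coincide.) -/
def alphaClass {X : Type*} [MetricSpace X] [MeasurableSpace X] (A : Set X) : Set (ℝ → ℝ) :=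
  {α | ∃ μ : Measure X, IsHomogeneousMeasure μ A ∧ ∃ x ∈ A, AlphaEquiv α (alphaAt μ x)}

/-- The pseudo-distance `χ(A,B) = limsup_{r → 0+} |log (α_A(r) / α_B(r))|`, with values in
`[0,∞]`.  For homogeneous sets `A` and `B` the upper limit is the same for every choice of the
representatives `α_A` and `α_B`; the supremum below is this common value. -/
def chi {X Y : Type*} [MetricSpace X] [MeasurableSpace X] [MetricSpace Y] [MeasurableSpace Y]
    (A : Set X) (B : Set Y) : ℝ≥0∞ :=
  ⨆ α ∈ alphaClass A, ⨆ β ∈ alphaClass B,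
    limsup (fun r : ℝ => ENNReal.ofReal |Real.log (α r / β r)|) (𝓝[>] (0 : ℝ))

/-! Moran sets -/

/-- `D₁` is geometrically similar to `D₂` with ratio `r`: `D₁ = S(D₂)` for some similitude `S`
with ratio `r`. -/
def GeomSimilar {d : ℕ} (D₁ D₂ : Set (EuclideanSpace ℝ (Fin d))) (r : ℝ) : Prop :=
  ∃ S : EuclideanSpace ℝ (Fin d) → EuclideanSpace ℝ (Fin d),
    (∀ x y, dist (S x) (S y) = r * dist x y) ∧ D₁ = S '' D₂

/-- The words of length `k` whose letter in position `t` (counted from `0`) is one of the `n t`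
letters `0, …, n t - 1`. -/
def moranWords (n : ℕ → ℕ) (k : ℕ) : Set (List ℕ) :=
  {σ | σ.length = k ∧ ∀ (t : ℕ) (ht : t < σ.length), σ[t] < n t}

/-- A Moran construction `(J_σ)` in `ℝ^d`, starting from `J = J_∅`, with `n k` children of ratio
`c k` for every basic element of order `k`; so `n k`, `c k` with `k = 0, 1, …` are the usual
`n_{k+1}`, `c_{k+1}`. -/
structure IsMoranConstruction {d : ℕ} (J : List ℕ → Set (EuclideanSpace ℝ (Fin d)))
    (n : ℕ → ℕ) (c : ℕ → ℝ) : Prop where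
  isCompact : IsCompact (J [])
  interior_nonempty : (interior (J [])).Nonempty
  ratio_mem : ∀ k, c k ∈ Ioo (0 : ℝ) 1
  two_le : ∀ k, 2 ≤ n k
  iInf_pos : 0 < ⨅ k, c k
  subset : ∀ k, ∀ σ ∈ moranWords n k, ∀ i < n k, J (σ ++ [i]) ⊆ J σ
  similar : ∀ k, ∀ σ ∈ moranWords n k, ∀ i < n k, GeomSimilar (J (σ ++ [i])) (J σ) (c k)
  disjoint : ∀ k, ∀ σ ∈ moranWords n k, ∀ i < n k, ∀ j < n k, i ≠ j →
    Disjoint (interior (J (σ ++ [i]))) (interior (J (σ ++ [j])))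

/-- `E` is a Moran set in `ℝ^d`. -/
def IsMoranSet {d : ℕ} (E : Set (EuclideanSpace ℝ (Fin d))) : Prop :=
  ∃ (J : List ℕ → Set (EuclideanSpace ℝ (Fin d))) (n : ℕ → ℕ) (c : ℕ → ℝ),
    IsMoranConstruction J n c ∧ E = ⋂ k : ℕ, ⋃ σ ∈ moranWords n k, J σ

/-! Bilipschitz maps -/

/-- `f` restricted to `E` is a bilipschitz map. -/
def IsBilipschitzOn {X Y : Type*} [MetricSpace X] [MetricSpace Y] (f : X → Y) (E : Set X) :
    Prop :=
  ∃ L : ℝ, 1 ≤ L ∧ ∀ x ∈ E, ∀ y ∈ E,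
    dist x y / L ≤ dist (f x) (f y) ∧ dist (f x) (f y) ≤ L * dist x y

/-! Packing measure and packing dimension -/

/-- `P`, a set of pairs (centre, radius), is a `δ`-packing of `A`: a countable family of pairwise
disjoint closed balls with centres in `A` and radii in `(0, δ]`. -/
def IsPacking {X : Type*} [MetricSpace X] (A : Set X) (δ : ℝ) (P : Set (X × ℝ)) : Prop :=
  P.Countable ∧ (∀ p ∈ P, p.1 ∈ A ∧ 0 < p.2 ∧ p.2 ≤ δ) ∧
    P.PairwiseDisjoint fun p => Metric.closedBall p.1 p.2

/-- The `s`-dimensional packing premeasure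
`P₀^s(A) = lim_{δ → 0} sup {∑ (2 rᵢ)^s : (B(xᵢ, rᵢ)) a δ-packing of A}`. -/
def packingPremeasure {X : Type*} [MetricSpace X] (s : ℝ≥0) (A : Set X) : ℝ≥0∞ :=
  ⨅ (δ : ℝ) (_ : 0 < δ), ⨆ (P : Set (X × ℝ)) (_ : IsPacking A δ P),
    ∑' p : P, ENNReal.ofReal (2 * (p : X × ℝ).2) ^ (s : ℝ)

/-- The `s`-dimensional packing measure `P^s(A) = inf {∑ᵢ P₀^s(Aᵢ) : A ⊆ ⋃ᵢ Aᵢ}`. -/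
def packingMeasure {X : Type*} [MetricSpace X] (s : ℝ≥0) (A : Set X) : ℝ≥0∞ :=
  ⨅ (U : ℕ → Set X) (_ : A ⊆ ⋃ i, U i), ∑' i, packingPremeasure s (U i)

/-- The packing dimension `sup {s ≥ 0 : P^s(A) = ∞}` (`0` if there is no such `s`). -/
def dimP {X : Type*} [MetricSpace X] (A : Set X) : ℝ≥0∞ :=
  ⨆ (s : ℝ≥0) (_ : packingMeasure s A = ∞), (s : ℝ≥0∞)

end HomogeneousFractal

end

noncomputable section

namespace HomogeneousFractal

/-! Maximal separated sets -/

/-! In a homogeneous set the mass of a ball depends, up to bounded factors, only on its radius. Fix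
a small ratio `c` and let `m k` be the mass of a ball of radius `R c^k`. Near every point of `A`
there is room for about `m k / m (k+1)` well separated points at the next scale, so every node of
level `k` of a tree in `A` can be given the same number `n k` of children. The ends of the tree form
a compact subset of `A` coded by sequences, on which the uniform product measure gives cylinders
mass `∏ 1 / n j`.

The constants lost at each level change this mass, relative to `m k`, by at most a factor of order
`(2D)^k`, where `D` does not depend on `c`. Choosing `c` so small that `log (2D) ≤ η |log c|` turns
the loss into `r^(±η)` at scale `r ≈ c^k`. Hence the logarithms of the two measures of balls differ
by at most `η |log r| + O(1)`; this is the core, `IsHomogeneousMeasure.exists_isPointTree`. A full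
net of `A` on the first level makes the subset Hausdorff close to `A`.

The geometry of a coded set is determined by `n`, `c` and `R` up to a factor `1/c`
(`IsCoding.dist_le_mul`), so a tree with the same data in a Euclidean space
(`exists_isPointTree_euclidean`) gives a bilipschitz copy. In a Euclidean space the balls around the
nodes form a Moran construction (`IsPointTree.isMoranSet`). The logarithmic estimate then bounds `χ`
by `chi_le` and the loss of dimension by `dim_le_dim_add`. -/

theorem exists_finset_separated_cover {X : Type*} [MetricSpace X] {T : Set X}
    (hT : TotallyBounded T) {r : ℝ} (hr : 0 < r) :
    ∃ S : Finset X, (∀ x ∈ S, x ∈ T) ∧ (∀ x ∈ S, ∀ y ∈ S, x ≠ y → r < dist x y) ∧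
      ∀ x ∈ T, ∃ y ∈ S, dist x y ≤ r := by
  classical
  -- If no separated set were maximal, each could be enlarged, and all cardinalities would occur.
  -- But two points more than `r` apart cannot share a point of an `r / 2`-net, so a finite net
  -- bounds the cardinality.
  by_contra! hcon
  have key : ∀ n : ℕ, ∃ S : Finset X, S.card = n ∧ (∀ x ∈ S, x ∈ T) ∧
      (∀ x ∈ S, ∀ y ∈ S, x ≠ y → r < dist x y) := by
    intro n
    induction n with
    | zero => exact ⟨∅, by simp⟩
    | succ n ih =>
      obtain ⟨S, hcard, hST, hS⟩ := ih
      obtain ⟨x, hxT, hx⟩ := hcon S hST hS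
      have hxS : x ∉ S := fun h => by simpa using hr.trans (hx x h)
      refine ⟨insert x S, by rw [Finset.card_insert_of_notMem hxS, hcard], ?_, ?_⟩
      · intro y hy
        rcases Finset.mem_insert.1 hy with rfl | hy
        exacts [hxT, hST y hy]
      · intro y hy z hz hyz
        rcases Finset.mem_insert.1 hy with hy' | hy' <;>
          rcases Finset.mem_insert.1 hz with hz' | hz'
        · exact absurd (hy'.trans hz'.symm) hyz
        · exact hy' ▸ hx z hz'
        · rw [dist_comm]; exact hz' ▸ hx y hy'
        · exact hS y hy' z hz' hyz
  obtain ⟨t, htf, ht⟩ := Metric.totallyBounded_iff.1 hT (r / 2) (by positivity)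
  obtain ⟨S, hcard, hST, hS⟩ := key (htf.toFinset.card + 1)
  have hc : ∀ x : X, ∃ y, x ∈ S → y ∈ t ∧ dist x y < r / 2 := by
    intro x
    by_cases hx : x ∈ S
    · obtain ⟨y, hy, hxy⟩ := mem_iUnion₂.1 (ht (hST x hx))
      exact ⟨y, fun _ => ⟨hy, hxy⟩⟩
    · exact ⟨x, fun h => absurd h hx⟩
  choose g hg using hc
  obtain ⟨x, hx, y, hy, hxy, hgxy⟩ :=
    Finset.exists_ne_map_eq_of_card_lt_of_maps_to (s := S) (t := htf.toFinset) (f := g)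
      (by omega) (fun x hx => by simpa using (hg x hx).1)
  have h1 := (hg x hx).2
  have h2 := (hg y hy).2
  rw [← hgxy] at h2
  have h3 := hS x hx y hy hxy
  have h4 := dist_triangle_right x y (g x)
  linarith

/-! Homogeneous measures -/

theorem subset_closedBall_of_diam_le {X : Type*} [MetricSpace X] {A : Set X}
    (hb : Bornology.IsBounded A) {x : X} (hx : x ∈ A) {r : ℝ}
    (hr : Metric.diam A ≤ r) : A ⊆ Metric.closedBall x r := fun _ hy =>
  (Metric.dist_le_diam_of_mem hb hy hx).trans hr

section Homogeneous

variable {X : Type*} [MetricSpace X] [MeasurableSpace X] {μ : Measure X} {A : Set X}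

theorem IsHomogeneousMeasure.real_pos (h : IsHomogeneousMeasure μ A) (hd : 0 < Metric.diam A)
    {x : X} (hx : x ∈ A) {r : ℝ} (hr : 0 < r) : 0 < μ.real (Metric.closedBall x r) := by
  have := h.prob
  have hmin : 0 < min r (Metric.diam A) := lt_min hr hd
  refine lt_of_lt_of_le ?_ (measureReal_mono
    (Metric.closedBall_subset_closedBall (min_le_left r (Metric.diam A))))
  obtain ⟨κ, δ, Δ, -, -, hδ, -, hall⟩ := h.ratio
  have h1 := (hall x hx _ hmin (min_le_right _ _)).1
  rcases (measureReal_nonneg (μ := μ)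
    (s := Metric.closedBall x (min r (Metric.diam A)))).eq_or_lt with h0 | h0
  · rw [← h0, zero_div] at h1; linarith
  · exact h0

theorem IsHomogeneousMeasure.real_eq_one (h : IsHomogeneousMeasure μ A)
    {S : Set X} (hS : A ⊆ S) : μ.real S = 1 := by
  have := h.prob
  have h0 : μ Sᶜ = 0 := measure_mono_null (compl_subset_compl.2 hS) h.supported
  have h1 : μ S = μ univ := measure_of_measure_compl_eq_zero h0
  simp [Measure.real, h1]

theorem IsHomogeneousMeasure.exists_real_le_mul (h : IsHomogeneousMeasure μ A)
    (hd : 0 < Metric.diam A) (hb : Bornology.IsBounded A) :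
    ∃ lam : ℝ, 1 ≤ lam ∧ ∀ x ∈ A, ∀ y ∈ A, ∀ r : ℝ, 0 < r →
      μ.real (Metric.closedBall x r) ≤ lam * μ.real (Metric.closedBall y r) := by
  obtain ⟨lam, hlam, hall⟩ := h.comparable
  refine ⟨lam, hlam, fun x hx y hy r hr => ?_⟩
  rcases le_or_gt r (Metric.diam A) with hrd | hrd
  · exact (div_le_iff₀ (h.real_pos hd hy hr)).1 (hall x hx y hy r hr hrd).2
  · rw [h.real_eq_one (subset_closedBall_of_diam_le hb hx hrd.le),
      h.real_eq_one (subset_closedBall_of_diam_le hb hy hrd.le)]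
    linarith

/-- Iterate the upper ratio bound until `κ ^ j < θ`. A ball of radius beyond the diameter has full
mass, which the ball of radius `diam A` has already. -/
theorem IsHomogeneousMeasure.doubling (h : IsHomogeneousMeasure μ A)
    (hd : 0 < Metric.diam A) (hb : Bornology.IsBounded A) {θ : ℝ} (hθ : 0 < θ) :
    ∃ C : ℝ, 1 ≤ C ∧ ∀ x ∈ A, ∀ r : ℝ, 0 < r →
      μ.real (Metric.closedBall x r) ≤ C * μ.real (Metric.closedBall x (θ * r)) := by
  have := h.prob
  obtain ⟨κ, δ, Δ, hκ, hκ1, hδ, hδΔ, hall⟩ := h.ratio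
  have hΔ : 1 ≤ Δ := by linarith
  have iter : ∀ j : ℕ, ∀ x ∈ A, ∀ r : ℝ, 0 < r → r ≤ Metric.diam A →
      μ.real (Metric.closedBall x r) ≤ Δ ^ j * μ.real (Metric.closedBall x (κ ^ j * r)) := by
    intro j
    induction j with
    | zero => intro x _ r _ _; simp
    | succ j ih =>
      intro x hx r hr hrd
      have hpos : 0 < κ ^ j * r := by positivity
      have hle : κ ^ j * r ≤ Metric.diam A :=
        (mul_le_of_le_one_left hr.le (pow_le_one₀ hκ.le hκ1.le)).trans hrd
      have h2 := (div_le_iff₀ (h.real_pos hd hx (mul_pos hκ hpos))).1 (hall x hx _ hpos hle).2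
      calc _ ≤ Δ ^ j * μ.real (Metric.closedBall x (κ ^ j * r)) := ih x hx r hr hrd
        _ ≤ Δ ^ j * (Δ * μ.real (Metric.closedBall x (κ * (κ ^ j * r)))) := by gcongr
        _ = _ := by rw [pow_succ, pow_succ]; ring_nf
  obtain ⟨j, hj⟩ := exists_pow_lt_of_lt_one hθ hκ1
  have small : ∀ x ∈ A, ∀ r : ℝ, 0 < r → r ≤ Metric.diam A →
      μ.real (Metric.closedBall x r) ≤ Δ ^ j * μ.real (Metric.closedBall x (θ * r)) := by
    intro x hx r hr hrd
    refine (iter j x hx r hr hrd).trans ?_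
    gcongr
    · exact measure_ne_top _ _
  refine ⟨Δ ^ j, one_le_pow₀ hΔ, fun x hx r hr => ?_⟩
  rcases le_or_gt r (Metric.diam A) with hrd | hrd
  · exact small x hx r hr hrd
  · rw [h.real_eq_one (subset_closedBall_of_diam_le hb hx hrd.le),
      ← h.real_eq_one (subset_closedBall_of_diam_le hb hx le_rfl)]
    refine (small x hx _ hd le_rfl).trans ?_
    gcongr
    · exact measure_ne_top _ _

/-- Reverse doubling, by iterating the lower ratio bound `δ > 1`. It forces every node of the tree
to have at least two children. -/
theorem IsHomogeneousMeasure.exists_mul_real_le (h : IsHomogeneousMeasure μ A)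
    (hd : 0 < Metric.diam A) (M : ℝ) :
    ∃ θ : ℝ, 0 < θ ∧ θ < 1 ∧ ∀ x ∈ A, ∀ r : ℝ, 0 < r → r ≤ Metric.diam A →
      M * μ.real (Metric.closedBall x (θ * r)) ≤ μ.real (Metric.closedBall x r) := by
  have := h.prob
  obtain ⟨κ, δ, Δ, hκ, hκ1, hδ, hδΔ, hall⟩ := h.ratio
  have iter : ∀ j : ℕ, ∀ x ∈ A, ∀ r : ℝ, 0 < r → r ≤ Metric.diam A →
      δ ^ j * μ.real (Metric.closedBall x (κ ^ j * r)) ≤ μ.real (Metric.closedBall x r) := by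
    intro j
    induction j with
    | zero => intro x _ r _ _; simp
    | succ j ih =>
      intro x hx r hr hrd
      have hpos : 0 < κ ^ j * r := by positivity
      have hle : κ ^ j * r ≤ Metric.diam A :=
        (mul_le_of_le_one_left hr.le (pow_le_one₀ hκ.le hκ1.le)).trans hrd
      have h2 := (le_div_iff₀ (h.real_pos hd hx (mul_pos hκ hpos))).1 (hall x hx _ hpos hle).1
      calc _ = δ ^ j * (δ * μ.real (Metric.closedBall x (κ * (κ ^ j * r)))) := by
            rw [pow_succ, pow_succ]; ring_nf
        _ ≤ δ ^ j * μ.real (Metric.closedBall x (κ ^ j * r)) := by gcongr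
        _ ≤ _ := ih x hx r hr hrd
  obtain ⟨j, hj⟩ := pow_unbounded_of_one_lt M hδ
  -- The exponent `j + 1` keeps `θ < 1` even when `j = 0`.
  refine ⟨κ ^ (j + 1), by positivity, pow_lt_one₀ hκ.le hκ1 (by omega), fun x hx r hr hrd => ?_⟩
  refine le_trans ?_ (iter (j + 1) x hx r hr hrd)
  gcongr
  exact hj.le.trans (pow_le_pow_right₀ hδ.le (by omega))

theorem real_le_card_mul [IsProbabilityMeasure μ] {lam : ℝ}
    (hlam : ∀ x ∈ A, ∀ y ∈ A, ∀ r : ℝ, 0 < r →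
      μ.real (Metric.closedBall x r) ≤ lam * μ.real (Metric.closedBall y r))
    {T : Set X} {S : Finset X} {r : ℝ} (hr : 0 < r) (hS : ∀ x ∈ S, x ∈ A)
    (hT : ∀ x ∈ T, ∃ y ∈ S, dist x y ≤ r) {x : X} (hx : x ∈ A) :
    μ.real T ≤ S.card * (lam * μ.real (Metric.closedBall x r)) := by
  have hsub : T ⊆ ⋃ y ∈ S, Metric.closedBall y r := fun z hz => by
    obtain ⟨y, hy, hzy⟩ := hT z hz
    exact mem_iUnion₂.2 ⟨y, hy, hzy⟩
  calc μ.real T ≤ μ.real (⋃ y ∈ S, Metric.closedBall y r) :=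
        measureReal_mono hsub (measure_ne_top _ _)
    _ ≤ ∑ y ∈ S, μ.real (Metric.closedBall y r) := measureReal_biUnion_finset_le _ _
    _ ≤ ∑ y ∈ S, lam * μ.real (Metric.closedBall x r) :=
        Finset.sum_le_sum fun y hy => hlam y (hS y hy) x hx r hr
    _ = _ := by rw [Finset.sum_const, nsmul_eq_mul]

theorem card_mul_real_le [BorelSpace X] [IsProbabilityMeasure μ] {lam : ℝ}
    (hlam : ∀ x ∈ A, ∀ y ∈ A, ∀ r : ℝ, 0 < r →
      μ.real (Metric.closedBall x r) ≤ lam * μ.real (Metric.closedBall y r)) (h0 : 0 ≤ lam)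
    {S : Finset X} {r : ℝ} (hr : 0 < r) (hS : ∀ x ∈ S, x ∈ A)
    (hsep : ∀ x ∈ S, ∀ y ∈ S, x ≠ y → r < dist x y) {x : X} (hx : x ∈ A) :
    S.card * μ.real (Metric.closedBall x (r / 2)) ≤ lam := by
  have hdis : PairwiseDisjoint (S : Set X) fun y => Metric.closedBall y (r / 2) := by
    intro y hy z hz hyz
    refine Set.disjoint_left.2 fun w hw hw' => ?_
    have h1 := hsep y hy z hz hyz
    have h2 := dist_triangle_left y z w
    rw [Metric.mem_closedBall] at hw hw'
    linarith
  calc S.card * μ.real (Metric.closedBall x (r / 2))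
      = ∑ y ∈ S, μ.real (Metric.closedBall x (r / 2)) := by
        rw [Finset.sum_const, nsmul_eq_mul]
    _ ≤ ∑ y ∈ S, lam * μ.real (Metric.closedBall y (r / 2)) :=
        Finset.sum_le_sum fun y hy => hlam x hx y (hS y hy) _ (by positivity)
    _ = lam * μ.real (⋃ y ∈ S, Metric.closedBall y (r / 2)) := by
        rw [← Finset.mul_sum, measureReal_biUnion_finset hdis
          fun _ _ => Metric.isClosed_closedBall.measurableSet]
    _ ≤ lam * 1 := by gcongr; exact measureReal_le_one
    _ = lam := mul_one _

/-- For a maximal `r`-separated set `S`, covering bounds the mass of an `r`-ball below, and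
disjointness bounds that of an `r / 2`-ball above, by multiples of `1 / S.card`. This number does
not involve the measure. -/
theorem IsHomogeneousMeasure.exists_real_le_mul_real [BorelSpace X] {μ' : Measure X}
    (h : IsHomogeneousMeasure μ A) (h' : IsHomogeneousMeasure μ' A)
    (hd : 0 < Metric.diam A) (hA : IsCompact A) :
    ∃ C : ℝ, 1 ≤ C ∧ ∀ x ∈ A, ∀ y ∈ A, ∀ r : ℝ, 0 < r →
      μ.real (Metric.closedBall x r) ≤ C * μ'.real (Metric.closedBall y r) := by
  have := h.prob
  have := h'.prob
  obtain ⟨lam, hlam, hall⟩ := h.exists_real_le_mul hd hA.isBounded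
  obtain ⟨lam', hlam', hall'⟩ := h'.exists_real_le_mul hd hA.isBounded
  obtain ⟨C, hC, hdoub⟩ := h.doubling hd hA.isBounded (θ := 1 / 2) (by norm_num)
  have h1lam : 1 ≤ lam * lam' := one_le_mul_of_one_le_of_one_le hlam hlam'
  refine ⟨C * (lam * lam'), one_le_mul_of_one_le_of_one_le hC h1lam, fun x hx y hy r hr => ?_⟩
  obtain ⟨S, hSA, hsep, hcov⟩ := exists_finset_separated_cover hA.totallyBounded hr
  have h1 := real_le_card_mul hall' hr hSA hcov hy
  rw [h'.real_eq_one le_rfl] at h1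
  have h2 := card_mul_real_le hall (by linarith) hr hSA hsep hx
  have h3 := hdoub x hx r hr
  rw [show 1 / 2 * r = r / 2 by ring] at h3
  set a := μ.real (Metric.closedBall x (r / 2))
  set b := μ'.real (Metric.closedBall y r)
  have hb : 0 ≤ b := measureReal_nonneg
  have ha : 0 ≤ a := measureReal_nonneg
  calc _ ≤ C * (a * 1) := by rw [mul_one]; exact h3
    _ ≤ C * (a * (S.card * (lam' * b))) := by gcongr
    _ = C * ((S.card * a) * (lam' * b)) := by ring
    _ ≤ C * (lam * (lam' * b)) := by gcongr
    _ = _ := by ring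

/-- Reverse doubling makes masses decay at least like a power of `r`. This keeps `α_A` away from
`0`, without which a small difference of two such functions would not control their quotient. -/
theorem IsHomogeneousMeasure.exists_le_neg_log (h : IsHomogeneousMeasure μ A)
    (hd : 0 < Metric.diam A) :
    ∃ t c : ℝ, 0 < t ∧ ∀ x ∈ A, ∀ r : ℝ, 0 < r → r ≤ Metric.diam A →
      t * -Real.log r - c ≤ -Real.log (μ.real (Metric.closedBall x r)) := by
  have := h.prob
  obtain ⟨θ, hθ, hθ1, hall⟩ := h.exists_mul_real_le hd 2
  set D := Metric.diam A
  have iter : ∀ k : ℕ, ∀ x ∈ A, 2 ^ k * μ.real (Metric.closedBall x (θ ^ k * D)) ≤ 1 := by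
    intro k x hx
    induction k with
    | zero => simp
    | succ k ih =>
      have := hall x hx (θ ^ k * D) (by positivity)
        (mul_le_of_le_one_left hd.le (pow_le_one₀ hθ.le hθ1.le))
      calc _ = 2 ^ k * (2 * μ.real (Metric.closedBall x (θ * (θ ^ k * D)))) := by
            rw [pow_succ, pow_succ]; ring_nf
        _ ≤ 2 ^ k * μ.real (Metric.closedBall x (θ ^ k * D)) := by gcongr
        _ ≤ 1 := ih
  have hlθ : Real.log θ < 0 := Real.log_neg hθ hθ1
  have hl2 : 0 < Real.log 2 := Real.log_pos (by norm_num)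
  refine ⟨Real.log 2 / -Real.log θ, Real.log 2 - Real.log 2 / -Real.log θ * Real.log D,
    div_pos hl2 (by linarith), fun x hx r hr hrD => ?_⟩
  obtain ⟨k, hk1, hk2⟩ := exists_nat_pow_near_of_lt_one (div_pos hr hd)
    ((div_le_one hd).2 hrD) hθ hθ1
  rw [div_le_iff₀ hd] at hk2
  have hm := h.real_pos hd hx hr
  have h1 : 2 ^ k * μ.real (Metric.closedBall x r) ≤ 1 := by
    refine le_trans ?_ (iter k x hx)
    gcongr
    exact measure_ne_top _ _
  have h2 := Real.log_le_log (by positivity) h1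
  rw [Real.log_mul (by positivity) hm.ne', Real.log_pow, Real.log_one] at h2
  have h3 := Real.log_lt_log (by positivity) hk1
  rw [Real.log_pow, Real.log_div hr.ne' hd.ne'] at h3
  push_cast at h3
  have h4 : Real.log 2 / -Real.log θ * (Real.log D - Real.log r) ≤ (k + 1) * Real.log 2 := by
    rw [div_mul_eq_mul_div, div_le_iff₀ (by linarith)]
    nlinarith
  linarith

theorem IsHomogeneousMeasure.exists_neg_log_le (h : IsHomogeneousMeasure μ A)
    (hd : 0 < Metric.diam A) (hb : Bornology.IsBounded A) :
    ∃ t c : ℝ, 0 < t ∧ ∀ x ∈ A, ∀ r : ℝ, 0 < r → r ≤ Metric.diam A →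
      -Real.log (μ.real (Metric.closedBall x r)) ≤ t * -Real.log r + c := by
  have := h.prob
  obtain ⟨C', hC', hall'⟩ := h.doubling hd hb (θ := 1 / 2) (by norm_num)
  -- The doubling constant is enlarged so that `log C`, hence the exponent, is strictly positive.
  obtain ⟨C, hC, hall⟩ : ∃ C : ℝ, 1 < C ∧ ∀ x ∈ A, ∀ r : ℝ, 0 < r →
      μ.real (Metric.closedBall x r) ≤ C * μ.real (Metric.closedBall x (1 / 2 * r)) :=
    ⟨C' + 1, by linarith, fun x hx r hr => (hall' x hx r hr).trans (by gcongr; linarith)⟩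
  set D := Metric.diam A
  have iter : ∀ k : ℕ, ∀ x ∈ A, 1 ≤ C ^ k * μ.real (Metric.closedBall x ((1 / 2) ^ k * D)) := by
    intro k x hx
    induction k with
    | zero => simp [h.real_eq_one (subset_closedBall_of_diam_le hb hx le_rfl), D]
    | succ k ih =>
      have := hall x hx ((1 / 2) ^ k * D) (by positivity)
      calc 1 ≤ C ^ k * μ.real (Metric.closedBall x ((1 / 2) ^ k * D)) := ih
        _ ≤ C ^ k * (C * μ.real (Metric.closedBall x (1 / 2 * ((1 / 2) ^ k * D)))) := by gcongr
        _ = _ := by rw [pow_succ, pow_succ]; ring_nf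
  have hl2 : 0 < Real.log 2 := Real.log_pos (by norm_num)
  have hlC : 0 < Real.log C := Real.log_pos hC
  refine ⟨Real.log C / Real.log 2, Real.log C + Real.log C / Real.log 2 * Real.log D,
    div_pos hlC hl2, fun x hx r hr hrD => ?_⟩
  obtain ⟨k, hk1, hk2⟩ := exists_nat_pow_near_of_lt_one (div_pos hr hd)
    ((div_le_one hd).2 hrD) (y := (1 / 2 : ℝ)) (by norm_num) (by norm_num)
  rw [lt_div_iff₀ hd] at hk1
  have hm := h.real_pos hd hx hr
  have h1 : 1 ≤ C ^ (k + 1) * μ.real (Metric.closedBall x r) := by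
    refine (iter (k + 1) x hx).trans ?_
    gcongr
    exact measure_ne_top _ _
  have h2 := Real.log_le_log (by positivity) h1
  rw [Real.log_mul (by positivity) hm.ne', Real.log_pow, Real.log_one] at h2
  have h3 := Real.log_le_log (by positivity) hk2
  rw [Real.log_pow, Real.log_div hr.ne' hd.ne', one_div, Real.log_inv] at h3
  push_cast at h2
  have h4 : k * Real.log C ≤ Real.log C / Real.log 2 * (Real.log D - Real.log r) := by
    rw [div_mul_eq_mul_div, le_div_iff₀ hl2]
    nlinarith
  linarith

end Homogeneous

/-! Codings by sequences -/

/-- Sequences whose `k`-th letter is one of `0, …, n k - 1`. -/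
abbrev Code (n : ℕ → ℕ) : Type := ∀ k, Fin (n k)

/-- The distance between the points coded by two sequences which first differ in position `k` lies
between `b c^(k+1)` and `b c^k`. -/
structure IsCoding {Y : Type*} [MetricSpace Y] {n : ℕ → ℕ} (π : Code n → Y) (b c : ℝ) : Prop where
  b_pos : 0 < b
  c_pos : 0 < c
  c_lt_one : c < 1
  two_le : ∀ k, 2 ≤ n k
  upper : ∀ k s t, (∀ j < k, s j = t j) → dist (π s) (π t) ≤ b * c ^ k
  lower : ∀ k s t, (∀ j < k, s j = t j) → s k ≠ t k → b * c ^ (k + 1) < dist (π s) (π t)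

/-- The uniform product measure on sequences. -/
def codeMeasure (n : ℕ → ℕ) : Measure (Code n) :=
  Measure.infinitePi fun k => ProbabilityTheory.uniformOn (univ : Set (Fin (n k)))

/-- The mass of a cylinder of order `k`. -/
def cylMass (n : ℕ → ℕ) (k : ℕ) : ℝ := ∏ j ∈ Finset.range k, (n j : ℝ)⁻¹

theorem cylMass_succ (n : ℕ → ℕ) (k : ℕ) : cylMass n (k + 1) = cylMass n k * (n k : ℝ)⁻¹ :=
  Finset.prod_range_succ _ _

theorem cylMass_pos {n : ℕ → ℕ} (hn : ∀ k, 2 ≤ n k) (k : ℕ) : 0 < cylMass n k :=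
  Finset.prod_pos fun j _ => inv_pos.2 (Nat.cast_pos.2 (by have := hn j; omega))

theorem cylMass_le_mul {n : ℕ → ℕ} (hn : ∀ k, 2 ≤ n k) {N : ℕ} (hN : ∀ k, n k ≤ N) (k : ℕ) :
    cylMass n k ≤ N * cylMass n (k + 1) := by
  have h0 : (0 : ℝ) < n k := Nat.cast_pos.2 (by have := hn k; omega)
  have h1 : (n k : ℝ) ≤ N := Nat.cast_le.2 (hN k)
  have h2 : cylMass n k = n k * cylMass n (k + 1) := by
    rw [cylMass_succ]; field_simp
  have := cylMass_pos hn (k + 1)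
  rw [h2]
  gcongr

theorem two_mul_cylMass_le {n : ℕ → ℕ} (hn : ∀ k, 2 ≤ n k) (k : ℕ) :
    2 * cylMass n (k + 1) ≤ cylMass n k := by
  have h0 : (2 : ℝ) ≤ n k := by exact_mod_cast hn k
  have h2 : cylMass n k = n k * cylMass n (k + 1) := by
    rw [cylMass_succ]; field_simp
  have := cylMass_pos hn (k + 1)
  rw [h2]
  gcongr

theorem isProbabilityMeasure_codeMeasure {n : ℕ → ℕ} (hn : ∀ k, 2 ≤ n k) :
    IsProbabilityMeasure (codeMeasure n) := by
  have : ∀ k, Nonempty (Fin (n k)) := fun k => ⟨⟨0, by have := hn k; omega⟩⟩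
  unfold codeMeasure
  infer_instance

theorem codeMeasure_cylinder {n : ℕ → ℕ} (hn : ∀ k, 2 ≤ n k) (s : Code n) (k : ℕ) :
    (codeMeasure n).real {t | ∀ j < k, s j = t j} = cylMass n k := by
  have : ∀ k, Nonempty (Fin (n k)) := fun k => ⟨⟨0, by have := hn k; omega⟩⟩
  have hset : {t : Code n | ∀ j < k, s j = t j} =
      Set.pi (Finset.range k : Set ℕ) fun j => {s j} := by
    ext t
    simp [eq_comm]
  rw [hset, Measure.real, codeMeasure, Measure.infinitePi_pi _ (by simp), ENNReal.toReal_prod]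
  refine Finset.prod_congr rfl fun j _ => ?_
  rw [ProbabilityTheory.uniformOn_univ]
  simp

namespace IsCoding

variable {Y : Type*} [MetricSpace Y] {n : ℕ → ℕ} {π : Code n → Y} {b c : ℝ}

/-- A first disagreement at `j < k` would give a distance above `b c^(j+1) ≥ b c^k`. So balls about
coded points are trapped in cylinders. -/
theorem eq_of_dist_le (h : IsCoding π b c) {k : ℕ} {s t : Code n}
    (hd : dist (π s) (π t) ≤ b * c ^ k) : ∀ j < k, s j = t j := by
  intro j
  induction j using Nat.strong_induction_on with
  | _ j ih =>
    intro hj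
    by_contra hne
    have h1 := h.lower j s t (fun i hi => ih i hi (hi.trans hj)) hne
    have h2 : b * c ^ k ≤ b * c ^ (j + 1) :=
      mul_le_mul_of_nonneg_left (pow_le_pow_of_le_one h.c_pos.le h.c_lt_one.le hj) h.b_pos.le
    linarith

theorem exists_scale (h : IsCoding π b c) {r : ℝ} (hr : 0 < r) (hrb : r ≤ b) :
    ∃ k : ℕ, b * c ^ (k + 1) < r ∧ r ≤ b * c ^ k := by
  obtain ⟨k, h1, h2⟩ := exists_nat_pow_near_of_lt_one (div_pos hr h.b_pos)
    ((div_le_one h.b_pos).2 hrb) h.c_pos h.c_lt_one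
  rw [lt_div_iff₀ h.b_pos] at h1
  rw [div_le_iff₀ h.b_pos] at h2
  exact ⟨k, by linarith, by linarith⟩

theorem dist_le (h : IsCoding π b c) (s t : Code n) : dist (π s) (π t) ≤ b := by
  simpa using h.upper 0 s t (by simp)

theorem continuous (h : IsCoding π b c) : Continuous π := by
  rw [continuous_iff_continuousAt]
  intro s
  rw [ContinuousAt, Metric.tendsto_nhds]
  intro ε hε
  obtain ⟨k, hk⟩ := exists_pow_lt_of_lt_one (div_pos hε h.b_pos) h.c_lt_one
  rw [lt_div_iff₀ h.b_pos] at hk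
  have hev : ∀ᶠ t : Code n in 𝓝 s, ∀ j ∈ Finset.range k, t j = s j := by
    rw [Filter.eventually_all_finset]
    intro j _
    exact (continuous_apply j).continuousAt.eventually
      ((isOpen_discrete ({s j} : Set (Fin (n j)))).mem_nhds rfl)
  filter_upwards [hev] with t ht
  have := h.upper k t s fun j hj => ht j (Finset.mem_range.2 hj)
  linarith

theorem injective (h : IsCoding π b c) : Function.Injective π := by
  intro s t hst
  funext j
  refine h.eq_of_dist_le (k := j + 1) ?_ j (by omega)
  rw [hst, dist_self]
  exact mul_nonneg h.b_pos.le (pow_nonneg h.c_pos.le _)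

theorem isCompact_range (h : IsCoding π b c) : IsCompact (range π) :=
  _root_.isCompact_range h.continuous

theorem diam_le (h : IsCoding π b c) : Metric.diam (range π) ≤ b := by
  refine Metric.diam_le_of_forall_dist_le h.b_pos.le ?_
  rintro _ ⟨s, rfl⟩ _ ⟨t, rfl⟩
  exact h.dist_le s t

theorem diam_pos (h : IsCoding π b c) : 0 < Metric.diam (range π) := by
  let s : Code n := fun k => ⟨0, by have := h.two_le k; omega⟩
  let t : Code n := fun k => ⟨1, by have := h.two_le k; omega⟩
  have h1 := h.lower 0 s t (by simp) (by simp [s, t])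
  have h2 := Metric.dist_le_diam_of_mem h.isCompact_range.isBounded (mem_range_self s)
    (mem_range_self t)
  have : 0 < b * c ^ (0 + 1) := mul_pos h.b_pos (pow_pos h.c_pos _)
  linarith

variable [MeasurableSpace Y] [BorelSpace Y]

theorem measurable (h : IsCoding π b c) : Measurable π := h.continuous.measurable

theorem real_ball_eq (h : IsCoding π b c) (x : Y) (r : ℝ) :
    ((codeMeasure n).map π).real (Metric.closedBall x r) =
      (codeMeasure n).real {t | dist (π t) x ≤ r} :=
  map_measureReal_apply h.measurable Metric.isClosed_closedBall.measurableSet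

theorem cylMass_le (h : IsCoding π b c) (s : Code n) {r : ℝ} {k : ℕ} (hr : b * c ^ k ≤ r) :
    cylMass n k ≤ ((codeMeasure n).map π).real (Metric.closedBall (π s) r) := by
  have := isProbabilityMeasure_codeMeasure h.two_le
  rw [h.real_ball_eq, ← codeMeasure_cylinder h.two_le s k]
  refine measureReal_mono (fun t ht => ?_) (measure_ne_top _ _)
  have := h.upper k s t ht
  rw [dist_comm] at this
  exact this.trans hr

theorem le_cylMass (h : IsCoding π b c) (s : Code n) {r : ℝ} {k : ℕ} (hr : r ≤ b * c ^ k) :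
    ((codeMeasure n).map π).real (Metric.closedBall (π s) r) ≤ cylMass n k := by
  have := isProbabilityMeasure_codeMeasure h.two_le
  rw [h.real_ball_eq, ← codeMeasure_cylinder h.two_le s k]
  refine measureReal_mono (fun t ht => ?_) (measure_ne_top _ _)
  refine h.eq_of_dist_le ?_
  rw [dist_comm]
  exact le_trans ht hr

/-- A ball with `b c^(k+1) < r ≤ b c^k` contains a cylinder of order `k + 1` and lies in one of
order `k`; since `n k ≤ N`, these masses differ by a factor at most `N`. -/
theorem isHomogeneousMeasure (h : IsCoding π b c) {N : ℕ} (hN : ∀ k, n k ≤ N) :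
    IsHomogeneousMeasure ((codeMeasure n).map π) (range π) := by
  have := isProbabilityMeasure_codeMeasure h.two_le
  have hprob : IsProbabilityMeasure ((codeMeasure n).map π) :=
    Measure.isProbabilityMeasure_map h.measurable.aemeasurable
  have hN1 : (2 : ℝ) ≤ N := by exact_mod_cast (h.two_le 0).trans (hN 0)
  have hb := h.b_pos
  have hc := h.c_pos
  have hpos := fun k => cylMass_pos h.two_le k
  have hup := fun k => cylMass_le_mul h.two_le hN k
  have key : ∀ s t : Code n, ∀ r : ℝ, 0 < r → r ≤ b →
      ((codeMeasure n).map π).real (Metric.closedBall (π s) r) /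
        ((codeMeasure n).map π).real (Metric.closedBall (π t) r) ≤ N := by
    intro s t r hr hrb
    obtain ⟨k, hk1, hk2⟩ := h.exists_scale hr hrb
    have h1 := h.le_cylMass s hk2
    have h2 := h.cylMass_le t hk1.le
    rw [div_le_iff₀ ((hpos _).trans_le h2)]
    exact h1.trans ((hup k).trans (by gcongr))
  -- Shrinking by `c` alone could leave both balls with mass `cylMass n (k + 1)`. Shrinking by `c ^
  -- 2` passes at least one full level, whence `δ = 2`, and at most three, whence `Δ = N ^ 3`.
  refine ⟨hprob, ?_, ⟨N, by linarith, ?_⟩, ⟨c ^ 2, 2, (N : ℝ) ^ 3, by positivity,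
    pow_lt_one₀ hc.le h.c_lt_one (by norm_num), by norm_num, ?_, ?_⟩⟩
  · rw [Measure.map_apply h.measurable h.isCompact_range.isClosed.measurableSet.compl]
    simp
  · rintro _ ⟨s, rfl⟩ _ ⟨t, rfl⟩ r hr hrd
    refine ⟨?_, key s t r hr (hrd.trans h.diam_le)⟩
    have h1 := key t s r hr (hrd.trans h.diam_le)
    obtain ⟨k, hk1, hk2⟩ := h.exists_scale hr (hrd.trans h.diam_le)
    have hs := (hpos _).trans_le (h.cylMass_le s hk1.le)
    have ht := (hpos _).trans_le (h.cylMass_le t hk1.le)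
    rw [inv_le_comm₀ (by linarith) (div_pos hs ht), inv_div]
    exact h1
  · nlinarith [pow_le_pow_right₀ (by linarith : (1 : ℝ) ≤ N) (by norm_num : 1 ≤ 3)]
  · rintro _ ⟨s, rfl⟩ r hr hrd
    obtain ⟨k, hk1, hk2⟩ := h.exists_scale hr (hrd.trans h.diam_le)
    have h1 := h.cylMass_le s hk1.le
    have h2 := h.le_cylMass s hk2
    have h3 : cylMass n (k + 3) ≤
        ((codeMeasure n).map π).real (Metric.closedBall (π s) (c ^ 2 * r)) := by
      refine h.cylMass_le s ?_
      calc b * c ^ (k + 3) = c ^ 2 * (b * c ^ (k + 1)) := by ring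
        _ ≤ c ^ 2 * r := by gcongr
    have h4 : ((codeMeasure n).map π).real (Metric.closedBall (π s) (c ^ 2 * r)) ≤
        cylMass n (k + 2) := by
      refine h.le_cylMass s ?_
      calc c ^ 2 * r ≤ c ^ 2 * (b * c ^ k) := by gcongr
        _ = _ := by ring
    have hm := (hpos _).trans_le h3
    constructor
    · rw [le_div_iff₀ hm]
      exact (mul_le_mul_of_nonneg_left h4 (by norm_num)).trans
        ((two_mul_cylMass_le h.two_le (k + 1)).trans h1)
    · rw [div_le_iff₀ hm]
      calc _ ≤ cylMass n k := h2
        _ ≤ N * (N * (N * cylMass n (k + 3))) := by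
          refine (hup k).trans ?_
          gcongr
          refine (hup (k + 1)).trans ?_
          gcongr
          exact hup (k + 2)
        _ = N ^ 3 * cylMass n (k + 3) := by ring
        _ ≤ _ := by gcongr

theorem isHomogeneous (h : IsCoding π b c) {N : ℕ} (hN : ∀ k, n k ≤ N) :
    IsHomogeneous (range π) :=
  ⟨h.isCompact_range, h.diam_pos, _, h.isHomogeneousMeasure hN⟩

end IsCoding

/-- In both spaces the first disagreement of two sequences puts their distance in the same interval
`(b c^(k+1), b c^k]`, whose endpoints have ratio `c`. -/
theorem IsCoding.dist_le_mul {Y Z : Type*} [MetricSpace Y] [MetricSpace Z] {n : ℕ → ℕ}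
    {π : Code n → Y} {π' : Code n → Z} {b c : ℝ} (h : IsCoding π b c) (h' : IsCoding π' b c)
    (s t : Code n) : dist (π s) (π t) ≤ c⁻¹ * dist (π' s) (π' t) := by
  have hc := h.c_pos
  rcases eq_or_ne s t with rfl | hst
  · simp
  obtain ⟨k, hk1, hk2⟩ := h'.exists_scale (dist_pos.2 (h'.injective.ne hst)) (h'.dist_le s t)
  have h1 := h.upper k s t (h'.eq_of_dist_le hk2)
  rw [inv_mul_eq_div, le_div_iff₀ hc]
  calc _ ≤ b * c ^ k * c := by gcongr
    _ = b * c ^ (k + 1) := by ring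
    _ ≤ _ := hk1.le

/-! Trees of points -/

/-- `ch k x i` is the `i`-th child of the point `x` of order `k`; the points of order `k` are the
centres of balls of radius `R c^k`. -/
structure IsPointTree {Y : Type*} [MetricSpace Y] (A : Set Y) (n : ℕ → ℕ) (c R : ℝ)
    (ch : ℕ → Y → ℕ → Y) : Prop where
  R_pos : 0 < R
  c_pos : 0 < c
  c_le : c ≤ 1 / 2
  two_le : ∀ k, 2 ≤ n k
  mem : ∀ k, ∀ x ∈ A, ∀ i < n k, ch k x i ∈ A
  near : ∀ k, ∀ x ∈ A, ∀ i < n k, dist (ch k x i) x ≤ R * c ^ k / 2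
  sep : ∀ k, ∀ x ∈ A, ∀ i < n k, ∀ j < n k, i ≠ j →
    4 * (R * c ^ (k + 1)) < dist (ch k x i) (ch k x j)

/-- The point of order `k` on the branch `s` of the tree with root `x₀`. -/
def treePoint {Y : Type*} (ch : ℕ → Y → ℕ → Y) (x₀ : Y) (s : ℕ → ℕ) : ℕ → Y
  | 0 => x₀
  | k + 1 => ch k (treePoint ch x₀ s k) (s k)

theorem treePoint_congr {Y : Type*} (ch : ℕ → Y → ℕ → Y) (x₀ : Y) {s t : ℕ → ℕ} {k : ℕ}
    (h : ∀ j < k, s j = t j) : treePoint ch x₀ s k = treePoint ch x₀ t k := by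
  induction k with
  | zero => rfl
  | succ k ih =>
    simp only [treePoint]
    rw [ih fun j hj => h j (by omega), h k (by omega)]

namespace IsPointTree

variable {Y : Type*} [MetricSpace Y] {A : Set Y} {n : ℕ → ℕ} {c R : ℝ} {ch : ℕ → Y → ℕ → Y}
  {x₀ : Y}

theorem radius_pos (h : IsPointTree A n c R ch) (k : ℕ) : 0 < R * c ^ k :=
  mul_pos h.R_pos (pow_pos h.c_pos k)

theorem treePoint_mem (h : IsPointTree A n c R ch) (hx₀ : x₀ ∈ A) {s : ℕ → ℕ}
    (hs : ∀ k, s k < n k) (k : ℕ) : treePoint ch x₀ s k ∈ A := by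
  induction k with
  | zero => exact hx₀
  | succ k ih => exact h.mem k _ ih _ (hs k)

theorem closedBall_child_subset (h : IsPointTree A n c R ch) (k : ℕ) {x : Y} (hx : x ∈ A)
    {i : ℕ} (hi : i < n k) :
    Metric.closedBall (ch k x i) (R * c ^ (k + 1)) ⊆ Metric.closedBall x (R * c ^ k) := by
  refine Metric.closedBall_subset_closedBall' ?_
  have h1 := h.near k x hx i hi
  have h2 : R * c ^ (k + 1) ≤ R * c ^ k / 2 := by
    have := mul_le_mul_of_nonneg_left h.c_le (h.radius_pos k).le
    rw [pow_succ]; linarith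
  linarith

theorem closedBall_subset (h : IsPointTree A n c R ch) (hx₀ : x₀ ∈ A) {s : ℕ → ℕ}
    (hs : ∀ k, s k < n k) {k m : ℕ} (hkm : k ≤ m) :
    Metric.closedBall (treePoint ch x₀ s m) (R * c ^ m) ⊆
      Metric.closedBall (treePoint ch x₀ s k) (R * c ^ k) := by
  induction m, hkm using Nat.le_induction with
  | base => exact Subset.rfl
  | succ m _ ih => exact (h.closedBall_child_subset m (h.treePoint_mem hx₀ hs m) (hs m)).trans ih

theorem tendsto_radius (h : IsPointTree A n c R ch) :
    Tendsto (fun k : ℕ => R * c ^ k) atTop (𝓝 0) := by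
  have := (tendsto_pow_atTop_nhds_zero_of_lt_one h.c_pos.le
    (by linarith [h.c_le] : c < 1)).const_mul R
  simpa using this

theorem exists_limit (h : IsPointTree A n c R ch) (hA : IsComplete A) (hx₀ : x₀ ∈ A) :
    ∃ π : Code n → Y, (∀ s, π s ∈ A) ∧
      ∀ s k, dist (π s) (treePoint ch x₀ (fun j => (s j : ℕ)) k) ≤ R * c ^ k := by
  have key : ∀ s : Code n, ∃ y ∈ A,
      ∀ k, dist y (treePoint ch x₀ (fun j => (s j : ℕ)) k) ≤ R * c ^ k := by
    intro s
    have hs : ∀ k, (s k : ℕ) < n k := fun k => (s k).2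
    have hball : ∀ k m, k ≤ m → treePoint ch x₀ (fun j => (s j : ℕ)) m ∈
        Metric.closedBall (treePoint ch x₀ (fun j => (s j : ℕ)) k) (R * c ^ k) := fun k m hkm =>
      h.closedBall_subset hx₀ hs hkm (Metric.mem_closedBall_self (h.radius_pos m).le)
    have hcau : CauchySeq (treePoint ch x₀ (fun j => (s j : ℕ))) :=
      cauchySeq_of_le_tendsto_0' _ (fun k m hkm => by
        rw [dist_comm]; exact hball k m hkm) h.tendsto_radius
    obtain ⟨y, hy, hlim⟩ := cauchySeq_tendsto_of_isComplete hA (h.treePoint_mem hx₀ hs) hcau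
    refine ⟨y, hy, fun k => ?_⟩
    exact Metric.isClosed_closedBall.mem_of_tendsto hlim
      (eventually_atTop.2 ⟨k, fun m hm => hball k m hm⟩)
  choose π hπ using key
  exact ⟨π, fun s => (hπ s).1, fun s => (hπ s).2⟩

/-- Points agreeing up to level `k` lie in one ball of radius `R c^k`. If they then separate, their
next centres are more than `4 R c^(k+1)` apart and each point is within `R c^(k+1)` of its centre.
The factor `4` in `sep` thus gives both bounds the same constant `2R`. -/
theorem isCoding (h : IsPointTree A n c R ch) (hx₀ : x₀ ∈ A) {π : Code n → Y}
    (hπ : ∀ s k, dist (π s) (treePoint ch x₀ (fun j => (s j : ℕ)) k) ≤ R * c ^ k) :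
    IsCoding π (2 * R) c where
  b_pos := by linarith [h.R_pos]
  c_pos := h.c_pos
  c_lt_one := by linarith [h.c_le]
  two_le := h.two_le
  upper k s t hst := by
    have h1 := hπ s k
    have h2 := hπ t k
    rw [← treePoint_congr ch x₀ (s := fun j => (s j : ℕ)) fun j hj => by rw [hst j hj]] at h2
    have := dist_triangle_right (π s) (π t) (treePoint ch x₀ (fun j => (s j : ℕ)) k)
    linarith
  lower k s t hst hne := by
    have h1 := hπ s (k + 1)
    have h2 := hπ t (k + 1)
    have h3 := h.sep k _ (h.treePoint_mem hx₀ (fun k => (s k).2) k) (s k) (s k).2 (t k) (t k).2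
      (fun he => hne (Fin.ext he))
    simp only [treePoint] at h1 h2
    rw [← treePoint_congr ch x₀ (s := fun j => (s j : ℕ)) fun j hj => by rw [hst j hj]] at h2
    have h4 := dist_triangle4 (ch k (treePoint ch x₀ (fun j => (s j : ℕ)) k) (s k)) (π s) (π t)
      (ch k (treePoint ch x₀ (fun j => (s j : ℕ)) k) (t k))
    rw [dist_comm _ (π s)] at h4
    linarith

end IsPointTree

/-! ### Moran sets from trees of balls -/

theorem geomSimilar_closedBall {d : ℕ} (x y : EuclideanSpace ℝ (Fin d)) {a r : ℝ} (ha : 0 < a) :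
    GeomSimilar (Metric.closedBall y (r * a)) (Metric.closedBall x r) a := by
  refine ⟨fun z => y + a • (z - x), fun z w => ?_, ?_⟩
  · rw [dist_add_left, dist_smul₀, dist_sub_right, Real.norm_of_nonneg ha.le]
  · ext z
    simp only [mem_image, Metric.mem_closedBall]
    constructor
    · intro hz
      refine ⟨x + a⁻¹ • (z - y), ?_, ?_⟩
      · rw [dist_eq_norm] at hz ⊢
        rw [add_sub_cancel_left, norm_smul, Real.norm_of_nonneg (inv_pos.2 ha).le,
          inv_mul_le_iff₀ ha]
        linarith
      · rw [add_sub_cancel_left, smul_smul, mul_inv_cancel₀ ha.ne', one_smul, add_sub_cancel]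
    · rintro ⟨w, hw, rfl⟩
      rw [dist_eq_norm] at hw ⊢
      rw [add_sub_cancel_left, norm_smul, Real.norm_of_nonneg ha.le, mul_comm r]
      gcongr

theorem getD_lt_of_mem_moranWords {n : ℕ → ℕ} (hn : ∀ k, 2 ≤ n k) {k : ℕ} {σ : List ℕ}
    (hσ : σ ∈ moranWords n k) (t : ℕ) : σ.getD t 0 < n t := by
  rcases lt_or_ge t σ.length with ht | ht
  · rw [List.getD_eq_getElem _ _ ht]
    exact hσ.2 t ht
  · rw [List.getD_eq_default _ _ ht]
    have := hn t
    omega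

theorem IsPointTree.isMoranSet {d : ℕ} {A : Set (EuclideanSpace ℝ (Fin d))} {n : ℕ → ℕ} {c R : ℝ}
    {ch : ℕ → EuclideanSpace ℝ (Fin d) → ℕ → EuclideanSpace ℝ (Fin d)}
    {x₀ : EuclideanSpace ℝ (Fin d)} (h : IsPointTree A n c R ch) (hx₀ : x₀ ∈ A)
    {π : Code n → EuclideanSpace ℝ (Fin d)}
    (hπ : ∀ s k, dist (π s) (treePoint ch x₀ (fun j => (s j : ℕ)) k) ≤ R * c ^ k) :
    IsMoranSet (range π) := by
  have hlast : ∀ (σ : List ℕ) (i : ℕ), (σ ++ [i]).getD σ.length 0 = i := by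
    intro σ i; simp
  have hinit : ∀ (σ : List ℕ) (i j : ℕ), j < σ.length → (σ ++ [i]).getD j 0 = σ.getD j 0 := by
    intro σ i j hj
    rw [List.getD_append _ _ _ _ hj]
  have hchild : ∀ (σ : List ℕ) (i : ℕ),
      treePoint ch x₀ (fun j => (σ ++ [i]).getD j 0) (σ.length + 1) =
        ch σ.length (treePoint ch x₀ (fun j => σ.getD j 0) σ.length) i := by
    intro σ i
    simp only [treePoint]
    rw [hlast, treePoint_congr ch x₀ fun j hj => hinit σ i j hj]
  -- A finite word is continued by the letter `0`, which is always admissible; the centre depends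
  -- only on the actual letters.
  refine ⟨fun σ => Metric.closedBall (treePoint ch x₀ (fun j => σ.getD j 0) σ.length)
    (R * c ^ σ.length), n, fun _ => c, ?_, ?_⟩
  · refine ⟨isCompact_closedBall _ _, ?_, fun _ => ⟨h.c_pos, by linarith [h.c_le]⟩, h.two_le,
      by simpa using h.c_pos, ?_, ?_, ?_⟩
    · exact ⟨_, Metric.ball_subset_interior_closedBall
        (Metric.mem_ball_self (h.radius_pos _))⟩
    · intro k σ hσ i hi
      have hk : σ.length = k := hσ.1
      subst hk
      simp only [List.length_append, List.length_cons, List.length_nil, zero_add]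
      rw [hchild]
      exact h.closedBall_child_subset _
        (h.treePoint_mem hx₀ (getD_lt_of_mem_moranWords h.two_le hσ) _) hi
    · intro k σ hσ i hi
      simp only [List.length_append, List.length_cons, List.length_nil, zero_add]
      rw [pow_succ, ← mul_assoc]
      exact geomSimilar_closedBall _ _ h.c_pos
    · intro k σ hσ i hi j hj hij
      have hk : σ.length = k := hσ.1
      subst hk
      refine Disjoint.mono interior_subset interior_subset ?_
      simp only [List.length_append, List.length_cons, List.length_nil, zero_add]
      rw [hchild, hchild]
      refine Metric.closedBall_disjoint_closedBall ?_
      have h1 := h.sep σ.length _ (h.treePoint_mem hx₀ (s := fun t => σ.getD t 0)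
        (getD_lt_of_mem_moranWords h.two_le hσ) σ.length) i hi j hj hij
      have h2 := h.radius_pos (σ.length + 1)
      linarith
  · apply Subset.antisymm
    · rintro _ ⟨s, rfl⟩
      obtain ⟨f, hf⟩ : ∃ f : ℕ → ℕ, f = fun j => (s j : ℕ) := ⟨_, rfl⟩
      have hfn : ∀ j, f j < n j := fun j => by rw [hf]; exact (s j).2
      refine mem_iInter.2 fun k => mem_iUnion₂.2 ⟨(List.range k).map f, ?_, ?_⟩
      · refine ⟨by simp, fun t ht => ?_⟩
        simpa using hfn t
      · have := hπ s k
        rw [← hf] at this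
        simp only [List.length_map, List.length_range]
        rwa [Metric.mem_closedBall, treePoint_congr ch x₀ (t := f)]
        intro j hj
        simp [List.getD_eq_getElem?_getD, hj]
    · intro y hy
      -- The words whose balls contain `y` at different levels need not extend one another, so no
      -- branch is extracted. Instead `y` is within `2 R c^k` of the closed set `range π` for every
      -- `k`.
      have hcl : IsClosed (range π) := (h.isCoding hx₀ hπ).isCompact_range.isClosed
      rw [← hcl.closure_eq, Metric.mem_closure_iff]
      intro ε hε
      obtain ⟨k, hk⟩ := (h.tendsto_radius.eventually (gt_mem_nhds (half_pos hε))).exists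
      obtain ⟨σ, hσ, hyσ⟩ := mem_iUnion₂.1 (mem_iInter.1 hy k)
      have hlen : σ.length = k := hσ.1
      subst hlen
      let s : Code n := fun t => ⟨σ.getD t 0, getD_lt_of_mem_moranWords h.two_le hσ t⟩
      refine ⟨π s, mem_range_self s, ?_⟩
      have h1 := hπ s σ.length
      have h2 := dist_triangle_right y (π s) (treePoint ch x₀ (fun j => σ.getD j 0) σ.length)
      have h3 : dist y (treePoint ch x₀ (fun j => σ.getD j 0) σ.length) ≤ R * c ^ σ.length := hyσ
      change dist (π s) (treePoint ch x₀ (fun j => σ.getD j 0) σ.length) ≤ _ at h1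
      linarith

/-- Orthogonal displacements give trees with arbitrary bounded branching numbers. -/
theorem exists_isPointTree_euclidean {n : ℕ → ℕ} {N : ℕ} (hn : ∀ k, 2 ≤ n k)
    (hN : ∀ k, n k ≤ N) {c R : ℝ} (hc : 0 < c) (hc' : c ≤ 1 / 8) (hR : 0 < R) :
    ∃ ch : ℕ → EuclideanSpace ℝ (Fin N) → ℕ → EuclideanSpace ℝ (Fin N),
      IsPointTree univ n c R ch := by
  classical
  refine ⟨fun k x i => x + if hi : i < N then
    EuclideanSpace.single (⟨i, hi⟩ : Fin N) (R * c ^ k / 2) else 0, hR, hc, by linarith, hn,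
    fun _ _ _ _ _ => mem_univ _, ?_, ?_⟩
  · intro k x _ i hi
    have hpos : 0 ≤ R * c ^ k / 2 := by positivity
    rw [dif_pos (hi.trans_le (hN k)), dist_eq_norm, add_sub_cancel_left,
      PiLp.norm_single, Real.norm_of_nonneg hpos]
  · intro k x _ i hi j hj hij
    have hpos : 0 < R * c ^ k / 2 := by positivity
    rw [dif_pos (hi.trans_le (hN k)), dif_pos (hj.trans_le (hN k)), dist_add_left]
    have hne : (⟨i, hi.trans_le (hN k)⟩ : Fin N) ≠ ⟨j, hj.trans_le (hN k)⟩ := by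
      simpa using hij
    set p : Fin N := ⟨i, hi.trans_le (hN k)⟩
    set q : Fin N := ⟨j, hj.trans_le (hN k)⟩
    have h1 : ‖EuclideanSpace.single p (R * c ^ k / 2) - EuclideanSpace.single q (R * c ^ k / 2)‖
        * ‖EuclideanSpace.single p (R * c ^ k / 2) - EuclideanSpace.single q (R * c ^ k / 2)‖ =
        ‖EuclideanSpace.single p (R * c ^ k / 2)‖ * ‖EuclideanSpace.single p (R * c ^ k / 2)‖ +
        ‖EuclideanSpace.single q (R * c ^ k / 2)‖ * ‖EuclideanSpace.single q (R * c ^ k / 2)‖ := by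
      refine norm_sub_sq_eq_norm_sq_add_norm_sq_real ?_
      rw [EuclideanSpace.inner_single_left]
      simp [hne]
    rw [PiLp.norm_single, PiLp.norm_single, Real.norm_of_nonneg hpos.le,
      ← dist_eq_norm] at h1
    -- Orthogonal displacements of length `R c^k / 2` are `√2` times that length apart; `c ≤ 1 / 8`
    -- puts the required separation at no more than that length.
    have h2 : 4 * (R * c ^ (k + 1)) ≤ R * c ^ k / 2 := by
      rw [pow_succ]
      have : R * c ^ k * c ≤ R * c ^ k * (1 / 8) := by gcongr
      linarith
    refine h2.trans_lt ?_
    by_contra hlt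
    have h3 := mul_self_le_mul_self dist_nonneg (not_lt.1 hlt)
    nlinarith [mul_pos hpos hpos]

/-! Trees of points in homogeneous sets -/

/-- Most levels of the tree use only `m` of the available points; the first uses all of them, and
the last clause then preserves the net property. -/
theorem exists_enumeration {X : Type*} (S : Finset X) (x : X) {m : ℕ} (hm : m ≤ S.card) :
    ∃ g : ℕ → X, (∀ i < m, g i ∈ S) ∧ (∀ i < m, ∀ j < m, i ≠ j → g i ≠ g j) ∧
      (m = S.card → ∀ a ∈ S, ∃ i < m, g i = a) := by
  refine ⟨fun i => if h : i < S.card then (S.equivFin.symm ⟨i, h⟩).1 else x, ?_, ?_, ?_⟩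
  · intro i hi
    dsimp only
    rw [dif_pos (hi.trans_le hm)]
    exact (S.equivFin.symm _).2
  · intro i hi j hj hij
    dsimp only
    rw [dif_pos (hi.trans_le hm), dif_pos (hj.trans_le hm)]
    intro he
    have := S.equivFin.symm.injective (Subtype.ext he)
    exact hij (by simpa using this)
  · rintro hmc a ha
    refine ⟨S.equivFin ⟨a, ha⟩, hmc ▸ (S.equivFin ⟨a, ha⟩).2, ?_⟩
    dsimp only
    rw [dif_pos (S.equivFin ⟨a, ha⟩).2]
    simp

/-- Passing to logarithms in a recursion for cylinder masses. -/
theorem abs_log_cylMass_sub_le {n : ℕ → ℕ} (hn : ∀ k, 2 ≤ n k) {m : ℕ → ℝ} (hm : ∀ k, 0 < m k)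
    {D : ℝ} (hD : 1 ≤ D) (hle : ∀ k, 1 ≤ k → n k * (D * m (k + 1)) ≤ m k)
    (hge : ∀ k, 1 ≤ k → m k ≤ 2 * (n k * (D * m (k + 1)))) :
    ∃ C, ∀ k : ℕ, |Real.log (cylMass n k) - Real.log (m k)| ≤ C + Real.log (2 * D) * k := by
  have hlD : 0 ≤ Real.log D := Real.log_nonneg hD
  have hl2D : 0 ≤ Real.log (2 * D) := Real.log_nonneg (by linarith)
  -- The recursion is only assumed from level `1` on, so the constant absorbs levels `0` and `1`.
  refine ⟨|Real.log (cylMass n 0) - Real.log (m 0)| + |Real.log (cylMass n 1) - Real.log (m 1)|,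
    fun k => ?_⟩
  rcases k with _ | k
  · simp
  induction k with
  | zero =>
    have := abs_nonneg (Real.log (cylMass n 0) - Real.log (m 0))
    push_cast
    linarith
  | succ k ih =>
    have hn0 : (0 : ℝ) < n (k + 1) := Nat.cast_pos.2 (by have := hn (k + 1); omega)
    have hD0 : 0 < D := by linarith
    have h1 := Real.log_le_log (mul_pos hn0 (mul_pos hD0 (hm (k + 1 + 1)))) (hle (k + 1) (by omega))
    have h2 := Real.log_le_log (hm _) (hge (k + 1) (by omega))
    rw [show 2 * (n (k + 1) * (D * m (k + 1 + 1))) = n (k + 1) * (2 * D * m (k + 1 + 1)) by ring,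
      Real.log_mul hn0.ne' (mul_pos (by linarith) (hm _)).ne',
      Real.log_mul (by linarith) (hm _).ne'] at h2
    rw [Real.log_mul hn0.ne' (mul_pos hD0 (hm _)).ne', Real.log_mul hD0.ne' (hm _).ne'] at h1
    rw [cylMass_succ n (k + 1), Real.log_mul (cylMass_pos hn _).ne' (inv_pos.2 hn0).ne',
      Real.log_inv]
    rw [abs_le] at ih ⊢
    push_cast at ih ⊢
    constructor <;> linarith [ih.1, ih.2]

/-- A volume count shows that each node of level `k ≥ 1` can have `⌊m k / (D m (k+1))⌋` children, so
`cylMass n k` follows `m k` with a bounded error per level. As `D` is fixed before `c`, a small `c`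
makes that error negligible against `|log c|`. -/
theorem IsHomogeneousMeasure.exists_isPointTree {X : Type*} [MetricSpace X] [MeasurableSpace X]
    [BorelSpace X] {μ : Measure X} {A : Set X} (h : IsHomogeneousMeasure μ A) (hA : IsCompact A)
    (hd : 0 < Metric.diam A) {ε η : ℝ} (hε : 0 < ε) (hη : 0 < η) :
    ∃ (n : ℕ → ℕ) (N : ℕ) (c R : ℝ) (ch : ℕ → X → ℕ → X) (x₀ : X),
      IsPointTree A n c R ch ∧ c ≤ 1 / 8 ∧ x₀ ∈ A ∧ (∀ k, n k ≤ N) ∧ R * c ≤ ε ∧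
      (∀ a ∈ A, ∃ i < n 0, dist a (ch 0 x₀ i) ≤ ε) ∧
      ∃ C : ℝ, ∀ x ∈ A, ∀ k : ℕ, ∀ r : ℝ, 2 * R * c ^ (k + 1) < r → r ≤ 2 * R * c ^ k →
        |Real.log (cylMass n k) - Real.log (μ.real (Metric.closedBall x r))| ≤
          η * |Real.log r| + C := by
  have := h.prob
  obtain ⟨lam, hlam, hcomp⟩ := h.exists_real_le_mul hd hA.isBounded
  obtain ⟨K, hK, hdoub⟩ := h.doubling hd hA.isBounded (θ := 1 / 4) (by norm_num)
  obtain ⟨x₀, hx₀⟩ : A.Nonempty := by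
    rw [nonempty_iff_ne_empty]
    rintro rfl
    simp at hd
  set L := Metric.diam A
  set D : ℝ := lam ^ 3 * K ^ 2 with hDdef
  have hD : 1 ≤ D := one_le_mul_of_one_le_of_one_le (one_le_pow₀ hlam) (one_le_pow₀ hK)
  obtain ⟨θ, hθ, hθ1, hrev⟩ := h.exists_mul_real_le hd (2 * D)
  -- In turn: `1 / 32` yields at least two points on the first level; `θ` yields two children on
  -- later levels; `ε / (8 L)` makes the first net `ε`-dense, as `4 ρ 1 = 8 c L`; the exponential
  -- gives `log (2D) ≤ η |log c|`.
  obtain ⟨c, hc, hc32, hcθ, hcε, hcη⟩ : ∃ c : ℝ, 0 < c ∧ c ≤ 1 / 32 ∧ c ≤ θ ∧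
      c ≤ ε / (8 * L) ∧ c ≤ Real.exp (-(Real.log (2 * D) / η)) := by
    refine ⟨min (min (1 / 32) θ) (min (ε / (8 * L)) (Real.exp (-(Real.log (2 * D) / η)))),
      ?_, ?_, ?_, ?_, ?_⟩
    · exact lt_min (lt_min (by norm_num) hθ) (lt_min (by positivity) (Real.exp_pos _))
    · exact (min_le_left _ _).trans (min_le_left _ _)
    · exact (min_le_left _ _).trans (min_le_right _ _)
    · exact (min_le_right _ _).trans (min_le_left _ _)
    · exact (min_le_right _ _).trans (min_le_right _ _)
  have hlogc : Real.log (2 * D) ≤ η * -Real.log c := by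
    have h1 := Real.log_le_log hc hcη
    rw [Real.log_exp] at h1
    have h2 : Real.log (2 * D) / η ≤ -Real.log c := by linarith
    rw [div_le_iff₀ hη] at h2
    linarith
  rw [le_div_iff₀ (by positivity)] at hcε
  -- With this radius all of `A` lies within `ρ 0 / 2 = L` of the root, so a net of the whole of `A`
  -- can serve as the first level.
  set R := 2 * L with hRdef
  have hR : 0 < R := by positivity
  set ρ : ℕ → ℝ := fun k => R * c ^ k with hρdef
  have hρ : ∀ k, 0 < ρ k := fun k => by positivity
  have hρsucc : ∀ k, ρ (k + 1) = c * ρ k := fun k => by simp only [hρdef]; ring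
  have hρ0 : ρ 0 = 2 * L := by simp [hρdef, hRdef]
  have hρ1 : ρ 1 = c * (2 * L) := by rw [← hρ0, ← hρsucc 0]
  have hρL : ∀ k, 1 ≤ k → ρ k ≤ L := by
    intro k hk
    induction k, hk using Nat.le_induction with
    | base => rw [hρ1]; nlinarith
    | succ k _ ih => rw [hρsucc]; nlinarith
  set m : ℕ → ℝ := fun k => μ.real (Metric.closedBall x₀ (ρ k)) with hmdef
  have hm : ∀ k, 0 < m k := fun k => h.real_pos hd hx₀ (hρ k)
  set q : ℕ → ℝ := fun k => m k / (D * m (k + 1)) with hqdef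
  have hDm : ∀ k, 0 < D * m k := fun k => mul_pos (by linarith) (hm k)
  have hq2 : ∀ k, 1 ≤ k → 2 ≤ q k := by
    intro k hk
    rw [hqdef, le_div_iff₀ (hDm _)]
    calc 2 * (D * m (k + 1)) = 2 * D * m (k + 1) := by ring
      _ ≤ 2 * D * μ.real (Metric.closedBall x₀ (θ * ρ k)) := by
        simp only [hmdef]
        rw [hρsucc]
        have := hρ k
        gcongr
        exact measure_ne_top _ _
      _ ≤ m k := hrev x₀ hx₀ _ (hρ k) (hρL k hk)
  -- The powers in `D = lam ^ 3 * K ^ 2` are spent here: `lam` for moving from `x₀` to `x`, between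
  -- net points and `x`, and back to `x₀`; `K` for reducing `ρ k` to `ρ k / 2` and `4 ρ (k+1)` to `ρ
  -- (k+1)`.
  have hcard : ∀ k, ∀ x ∈ A, ∀ S : Finset X, (∀ y ∈ S, y ∈ A) →
      (∀ y ∈ A ∩ Metric.closedBall x (ρ k / 2), ∃ z ∈ S, dist y z ≤ 4 * ρ (k + 1)) →
      q k ≤ S.card := by
    intro k x hx S hSA hS
    have h1 := real_le_card_mul hcomp (mul_pos four_pos (hρ (k + 1))) hSA hS hx
    have h2 : μ.real (A ∩ Metric.closedBall x (ρ k / 2)) =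
        μ.real (Metric.closedBall x (ρ k / 2)) := by
      rw [inter_comm]
      exact congrArg ENNReal.toReal (measure_inter_conull h.supported)
    rw [h2] at h1
    rw [hqdef, div_le_iff₀ (hDm _)]
    have h3 : m k ≤ lam * (K * μ.real (Metric.closedBall x (ρ k / 2))) := by
      refine (hcomp x₀ hx₀ x hx _ (hρ k)).trans ?_
      gcongr
      refine (hdoub x hx _ (hρ k)).trans ?_
      have := hρ k
      gcongr
      · exact measure_ne_top _ _
      · linarith
    have h4 : μ.real (Metric.closedBall x (4 * ρ (k + 1))) ≤ lam * (K * m (k + 1)) := by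
      refine (hcomp x hx x₀ hx₀ _ (mul_pos four_pos (hρ _))).trans ?_
      gcongr
      refine (hdoub x₀ hx₀ _ (mul_pos four_pos (hρ _))).trans ?_
      rw [show 1 / 4 * (4 * ρ (k + 1)) = ρ (k + 1) by ring]
    calc m k ≤ lam * (K * (S.card * (lam * (lam * (K * m (k + 1)))))) := by
          refine h3.trans ?_
          gcongr
          refine h1.trans ?_
          gcongr
      _ = _ := by rw [hDdef]; ring
  obtain ⟨S₀, hS₀A, hS₀sep, hS₀cov⟩ :=
    exists_finset_separated_cover hA.totallyBounded (mul_pos four_pos (hρ 1))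
  have hS₀card : 2 ≤ S₀.card := by
    by_contra hlt
    have hone : S₀.card ≤ 1 := by omega
    have : L ≤ 8 * ρ 1 := by
      refine Metric.diam_le_of_forall_dist_le (by have := hρ 1; linarith) fun x hx y hy => ?_
      obtain ⟨a, ha, hxa⟩ := hS₀cov x hx
      obtain ⟨b, hb, hyb⟩ := hS₀cov y hy
      rw [Finset.card_le_one.1 hone a ha b hb] at hxa
      have := dist_triangle_right x y b
      linarith
    rw [hρ1] at this
    nlinarith
  set n : ℕ → ℕ := fun k => if k = 0 then S₀.card else ⌊q k⌋₊ with hndef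
  have hn0 : n 0 = S₀.card := by simp [hndef]
  have hnk : ∀ k, 1 ≤ k → n k = ⌊q k⌋₊ := fun k hk => by
    simp only [hndef]; rw [if_neg (by omega)]
  have hn2 : ∀ k, 2 ≤ n k := by
    intro k
    rcases Nat.eq_zero_or_pos k with rfl | hk
    · rwa [hn0]
    · rw [hnk k hk]
      exact Nat.le_floor (by exact_mod_cast hq2 k hk)
  have hnq : ∀ k, 1 ≤ k → (n k : ℝ) ≤ q k := fun k hk => by
    rw [hnk k hk]
    exact Nat.floor_le (by linarith [hq2 k hk])
  have hqn : ∀ k, 1 ≤ k → q k ≤ 2 * n k := fun k hk => by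
    have h1 := Nat.lt_floor_add_one (q k)
    have h2 : (2 : ℝ) ≤ n k := by exact_mod_cast hn2 k
    rw [← hnk k hk] at h1
    linarith
  have hch : ∀ (k : ℕ) (x : X), ∃ g : ℕ → X, x ∈ A →
      (∀ i < n k, g i ∈ A ∧ dist (g i) x ≤ ρ k / 2) ∧
      (∀ i < n k, ∀ j < n k, i ≠ j → 4 * ρ (k + 1) < dist (g i) (g j)) ∧
      (k = 0 → ∀ a ∈ A, ∃ i < n 0, dist a (g i) ≤ 4 * ρ 1) := by
    intro k x
    by_cases hx : x ∈ A
    swap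
    · exact ⟨fun _ => x, fun hxA => absurd hxA hx⟩
    rcases Nat.eq_zero_or_pos k with rfl | hk
    · obtain ⟨g, hg1, hg2, hg3⟩ := exists_enumeration S₀ x hn0.le
      refine ⟨g, fun _ => ⟨fun i hi => ⟨hS₀A _ (hg1 i hi), ?_⟩, fun i hi j hj hij =>
        hS₀sep _ (hg1 i hi) _ (hg1 j hj) (hg2 i hi j hj hij), fun _ a ha => ?_⟩⟩
      · rw [hρ0]
        have := Metric.dist_le_diam_of_mem hA.isBounded (hS₀A _ (hg1 i hi)) hx
        linarith
      · obtain ⟨b, hb, hab⟩ := hS₀cov a ha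
        obtain ⟨i, hi, rfl⟩ := hg3 hn0 b hb
        exact ⟨i, hi, hab⟩
    · obtain ⟨S, hST, hSsep, hScov⟩ := exists_finset_separated_cover
        (hA.totallyBounded.subset (inter_subset_left (t := Metric.closedBall x (ρ k / 2))))
        (mul_pos four_pos (hρ (k + 1)))
      have hle : n k ≤ S.card := by
        have h1 := hcard k x hx S (fun y hy => (hST y hy).1) hScov
        exact_mod_cast (hnq k hk).trans h1
      obtain ⟨g, hg1, hg2, -⟩ := exists_enumeration S x hle
      exact ⟨g, fun _ => ⟨fun i hi => ⟨(hST _ (hg1 i hi)).1, (hST _ (hg1 i hi)).2⟩,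
        fun i hi j hj hij => hSsep _ (hg1 i hi) _ (hg1 j hj) (hg2 i hi j hj hij),
        fun hk0 => by omega⟩⟩
  choose ch hch using hch
  obtain ⟨Kc, hKc, hdoubc⟩ := h.doubling hd hA.isBounded hc
  obtain ⟨C, hC⟩ := abs_log_cylMass_sub_le hn2 hm hD
    (fun k hk => (le_div_iff₀ (hDm _)).1 (hnq k hk))
    (fun k hk => by
      have := (div_le_iff₀ (hDm (k + 1))).1 (hqn k hk)
      linarith)
  have hKlam : 1 ≤ lam * K := one_le_mul_of_one_le_of_one_le hlam hK
  have hKclam : 1 ≤ lam * Kc := one_le_mul_of_one_le_of_one_le hlam hKc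
  -- Doubling at ratio `c` gives `q k ≤ Kc`, which bounds the branching on all levels but the first.
  refine ⟨n, S₀.card + ⌊Kc⌋₊, c, R, ch, x₀, ⟨hR, hc, by linarith, hn2,
    fun k x hx i hi => ((hch k x hx).1 i hi).1, fun k x hx i hi => ((hch k x hx).1 i hi).2,
    fun k x hx => (hch k x hx).2.1⟩, by linarith, hx₀, ?_, by nlinarith, ?_, ?_⟩
  · intro k
    rcases Nat.eq_zero_or_pos k with rfl | hk
    · rw [hn0]; omega
    · rw [hnk k hk]
      refine (Nat.floor_le_floor ?_).trans (Nat.le_add_left _ _)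
      rw [hqdef, div_le_iff₀ (hDm _)]
      have h1 := hdoubc x₀ hx₀ _ (hρ k)
      rw [← hρsucc] at h1
      have h2 : m (k + 1) ≤ D * m (k + 1) := le_mul_of_one_le_left (hm _).le hD
      exact h1.trans (by gcongr)
  · intro a ha
    obtain ⟨i, hi, hai⟩ := (hch 0 x₀ hx₀).2.2 rfl a ha
    refine ⟨i, hi, hai.trans ?_⟩
    rw [hρ1]
    linarith
  · refine ⟨C + (Real.log (lam * K) + Real.log (lam * Kc)) + η * |Real.log (2 * R)|,
      fun x hx k r hkr hrk => ?_⟩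
    have hr : 0 < r := lt_trans (by positivity) hkr
    have hmr := h.real_pos hd hx hr
    have h1 := hC k
    have h2 : μ.real (Metric.closedBall x r) ≤ lam * K * m k := by
      rw [mul_assoc]
      refine (hcomp x hx x₀ hx₀ r hr).trans ?_
      gcongr
      refine (hdoub x₀ hx₀ r hr).trans ?_
      have := hρ k
      simp only [hmdef]
      gcongr
      · exact measure_ne_top _ _
      · simp only [hρdef] at this ⊢; linarith
    have h3 : m k ≤ lam * Kc * μ.real (Metric.closedBall x r) := by
      calc m k ≤ Kc * μ.real (Metric.closedBall x₀ r) := by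
            refine (hdoubc x₀ hx₀ _ (hρ k)).trans ?_
            gcongr
            · exact measure_ne_top _ _
            · rw [← hρsucc]
              have := hρ (k + 1)
              simp only [hρdef] at this ⊢
              linarith
        _ ≤ Kc * (lam * μ.real (Metric.closedBall x r)) := by
            gcongr
            exact hcomp x₀ hx₀ x hx r hr
        _ = _ := by ring
    have h2' := Real.log_le_log hmr h2
    have h3' := Real.log_le_log (hm k) h3
    rw [Real.log_mul (by linarith) (hm k).ne'] at h2'
    rw [Real.log_mul (by linarith) hmr.ne'] at h3'
    have h4 := Real.log_le_log hr hrk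
    rw [Real.log_mul (by positivity) (by positivity), Real.log_pow] at h4
    -- Since `r ≤ 2 R c^k`, the number `k |log c|` is at most `|log r|` plus a constant.
    have h5 : Real.log (2 * D) * k ≤ η * |Real.log (2 * R)| + η * |Real.log r| := by
      have ha := le_abs_self (Real.log (2 * R))
      have hb := neg_le_abs (Real.log r)
      calc Real.log (2 * D) * k ≤ η * -Real.log c * k := by gcongr
        _ = η * (k * -Real.log c) := by ring
        _ ≤ η * (|Real.log (2 * R)| + |Real.log r|) := by gcongr; linarith
        _ = _ := by ring
    have hl1 := Real.log_nonneg hKlam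
    have hl2 := Real.log_nonneg hKclam
    rw [abs_le] at h1 ⊢
    constructor <;> linarith [h1.1, h1.2]

/-! Dimensions and the growth of measures of balls -/

section Dimension

variable {X : Type*} [MetricSpace X]

theorem packingMeasure_mono {s : ℝ≥0} {A B : Set X} (hAB : A ⊆ B) :
    packingMeasure s A ≤ packingMeasure s B :=
  le_iInf₂ fun U hU => iInf₂_le U (hAB.trans hU)

theorem dimP_mono {A B : Set X} (hAB : A ⊆ B) : dimP A ≤ dimP B :=
  iSup₂_le fun s hs => le_iSup₂ (f := fun (s : ℝ≥0) (_ : packingMeasure s B = ∞) => (s : ℝ≥0∞)) s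
    (top_le_iff.1 (hs ▸ packingMeasure_mono hAB))

theorem packingPremeasure_empty (s : ℝ≥0) : packingPremeasure s (∅ : Set X) = 0 := by
  refine le_antisymm ?_ zero_le
  refine iInf₂_le_of_le 1 one_pos (iSup₂_le fun P hP => ?_)
  have : P = ∅ := eq_empty_of_forall_notMem fun p hp => (hP.2.1 p hp).1
  subst this
  simp

theorem packingMeasure_le_premeasure (s : ℝ≥0) (A : Set X) :
    packingMeasure s A ≤ packingPremeasure s A := by
  refine iInf₂_le_of_le (fun i : ℕ => if i = 0 then A else ∅) ?_ ?_
  · intro x hx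
    exact mem_iUnion.2 ⟨0, by simpa using hx⟩
  · rw [tsum_eq_single 0 fun i hi => by
      simp only [if_neg hi, packingPremeasure_empty]]
    simp

theorem eventually_nhdsGT_zero_lt {a : ℝ} (ha : 0 < a) : ∀ᶠ r : ℝ in 𝓝[>] 0, 0 < r ∧ r < a := by
  filter_upwards [self_mem_nhdsWithin, mem_nhdsWithin_of_mem_nhds (gt_mem_nhds ha)] with r h1 h2
  exact ⟨h1, h2⟩

variable [MeasurableSpace X] {μ : Measure X} {A : Set X}

/-- Some piece of any countable cover meets `A` in a set `T` of positive mass. At a scale where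
balls have mass at most `r^s'`, a maximal `r`-separated subset of `T` has at least about `μ T ·
r^(-s')` points. The balls of radius `r / 2` about them form a packing with sum of order `r^(s -
s')`, which is unbounded; one sequence of scales is enough. -/
theorem IsHomogeneousMeasure.le_dimP_of_frequently (hμ : IsHomogeneousMeasure μ A)
    (hA : IsCompact A) (hd : 0 < Metric.diam A) {s s' : ℝ≥0} (hss' : s < s')
    (h : ∃ᶠ r : ℝ in 𝓝[>] 0, ∃ x ∈ A, μ.real (Metric.closedBall x r) ≤ r ^ (s' : ℝ)) :
    (s : ℝ≥0∞) ≤ dimP A := by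
  classical
  have := hμ.prob
  obtain ⟨lam, hlam, hcomp⟩ := hμ.exists_real_le_mul hd hA.isBounded
  have hlam0 : 0 < lam := by linarith
  have hss : (s : ℝ) - s' < 0 := by
    have : (s : ℝ) < s' := by exact_mod_cast hss'
    linarith
  refine le_iSup₂_of_le s (top_le_iff.1 (le_iInf₂ fun U hU => ?_)) le_rfl
  obtain ⟨i, hi⟩ : ∃ i, μ (U i ∩ A) ≠ 0 := by
    by_contra! hcon
    have h0 : μ (⋃ i, U i ∩ A) = 0 := measure_iUnion_null hcon
    have h1 : A ⊆ ⋃ i, U i ∩ A := fun x hx => by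
      obtain ⟨i, hi⟩ := mem_iUnion.1 (hU hx)
      exact mem_iUnion.2 ⟨i, hi, hx⟩
    have h2 := hμ.real_eq_one h1
    rw [Measure.real, h0] at h2
    simp at h2
  refine (ENNReal.tsum_eq_top_of_eq_top ⟨i, top_le_iff.1 ?_⟩).ge
  set T := U i ∩ A with hT
  have hTpos : 0 < μ.real T := ENNReal.toReal_pos hi (measure_ne_top _ _)
  refine le_iInf₂ fun δ hδ => ?_
  refine (ENNReal.eq_top_of_forall_nnreal_le fun M => ?_).ge
  have hlarge : ∀ᶠ r : ℝ in 𝓝[>] 0, (M : ℝ) < μ.real T / lam * r ^ ((s : ℝ) - s') :=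
    ((tendsto_rpow_neg_nhdsGT_zero hss).const_mul_atTop
      (div_pos hTpos hlam0)).eventually_gt_atTop _
  obtain ⟨r, ⟨x, hx, hxr⟩, hrM, hr, hrδ⟩ :=
    (h.and_eventually (hlarge.and (eventually_nhdsGT_zero_lt hδ))).exists
  obtain ⟨S, hST, hSsep, hScov⟩ := exists_finset_separated_cover
    (hA.totallyBounded.subset (inter_subset_right : T ⊆ A)) hr
  have hcard := real_le_card_mul hcomp hr (fun y hy => (hST y hy).2) hScov hx
  let P : Finset (X × ℝ) := S.image fun y => (y, r / 2)
  have hpack : IsPacking (U i) δ (P : Set (X × ℝ)) := by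
    refine ⟨P.countable_toSet, ?_, ?_⟩
    · intro p hp
      obtain ⟨y, hy, rfl⟩ := Finset.mem_image.1 (Finset.mem_coe.1 hp)
      exact ⟨(hST y hy).1, by dsimp only; positivity, by dsimp only; linarith⟩
    · intro p hp q hq hpq
      obtain ⟨y, hy, rfl⟩ := Finset.mem_image.1 (Finset.mem_coe.1 hp)
      obtain ⟨z, hz, rfl⟩ := Finset.mem_image.1 (Finset.mem_coe.1 hq)
      refine Metric.closedBall_disjoint_closedBall ?_
      have := hSsep y hy z hz fun he => hpq (by rw [he])
      dsimp only
      linarith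
  refine le_trans ?_ (le_iSup₂ (f := fun (P : Set (X × ℝ)) (_ : IsPacking (U i) δ P) =>
    ∑' p : P, ENNReal.ofReal (2 * (p : X × ℝ).2) ^ (s : ℝ)) (P : Set (X × ℝ)) hpack)
  rw [Finset.tsum_subtype' P fun p : X × ℝ => ENNReal.ofReal (2 * p.2) ^ (s : ℝ),
    Finset.sum_image (fun y _ z _ he => (Prod.ext_iff.1 he).1)]
  dsimp only
  rw [Finset.sum_const, nsmul_eq_mul,
    ENNReal.ofReal_rpow_of_nonneg (by positivity) s.coe_nonneg, ← ENNReal.ofReal_natCast,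
    ← ENNReal.ofReal_mul (Nat.cast_nonneg _), ← ENNReal.ofReal_coe_nnreal]
  refine ENNReal.ofReal_le_ofReal (hrM.le.trans ?_)
  rw [Real.rpow_sub hr, div_mul_div_comm, div_le_iff₀ (by positivity)]
  rw [show 2 * (r / 2) = r by ring]
  calc μ.real T * r ^ (s : ℝ) ≤ S.card * (lam * r ^ (s' : ℝ)) * r ^ (s : ℝ) := by
        gcongr
        exact hcard.trans (by gcongr)
    _ = _ := by ring

variable [BorelSpace X]

/-- The mass distribution principle: `μ` is dominated by the Hausdorff measure. -/
theorem le_dimH_of_eventually [IsProbabilityMeasure μ] (hμ : μ Aᶜ = 0) {s : ℝ≥0}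
    (h : ∀ᶠ r : ℝ in 𝓝[>] 0, ∀ x ∈ A, μ.real (Metric.closedBall x r) ≤ r ^ (s : ℝ)) :
    (s : ℝ≥0∞) ≤ dimH A := by
  rcases eq_or_ne s 0 with rfl | hs
  · simp
  have hs0 : (0 : ℝ) < s := by positivity
  obtain ⟨r₀, hr₀, hr₀'⟩ := mem_nhdsGT_iff_exists_Ioo_subset.1 h
  have hr₀pos : 0 < r₀ := hr₀
  have hle : μ ≤ Measure.hausdorffMeasure (s : ℝ) := by
    refine Measure.le_hausdorffMeasure _ μ (ENNReal.ofReal (r₀ / 2)) (by simpa using hr₀pos)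
      fun S hS => ?_
    rcases (S ∩ A).eq_empty_or_nonempty with hemp | ⟨x, hxS, hxA⟩
    · have : S ⊆ Aᶜ := fun y hy hyA => by
        have : y ∈ S ∩ A := ⟨hy, hyA⟩
        rw [hemp] at this
        exact this
      rw [measure_mono_null this hμ]
      exact zero_le
    have htop : Metric.ediam S ≠ ∞ := ne_top_of_le_ne_top ENNReal.ofReal_ne_top hS
    have hD : Metric.diam S ≤ r₀ / 2 := ENNReal.toReal_le_of_le_ofReal (by positivity) hS
    have hD0 : 0 ≤ Metric.diam S := Metric.diam_nonneg
    have hDe : ENNReal.ofReal (Metric.diam S) = Metric.ediam S := ENNReal.ofReal_toReal htop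
    -- The hypothesis concerns positive radii while `S` may have diameter `0`; so `S` is placed in
    -- balls of radius `r > diam S`, and `r` decreases to `diam S`.
    have hlim : Tendsto (fun r : ℝ => r ^ (s : ℝ)) (𝓝[>] (Metric.diam S))
        (𝓝 (Metric.diam S ^ (s : ℝ))) :=
      ((Real.continuous_rpow_const hs0.le).tendsto _).mono_left nhdsWithin_le_nhds
    have hball : μ.real S ≤ Metric.diam S ^ (s : ℝ) := by
      refine ge_of_tendsto hlim ?_
      filter_upwards [self_mem_nhdsWithin, mem_nhdsWithin_of_mem_nhds
        (gt_mem_nhds (by linarith : Metric.diam S < r₀))] with r hr1 hr2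
      have hr1' : Metric.diam S < r := hr1
      refine (measureReal_mono (fun y hy => ?_) (measure_ne_top _ _)).trans
        (hr₀' ⟨by linarith, hr2⟩ x hxA)
      exact (Metric.dist_le_diam_of_mem' htop hy hxS).trans hr1'.le
    rw [← hDe, ENNReal.ofReal_rpow_of_nonneg hD0 hs0.le]
    exact (ENNReal.le_ofReal_iff_toReal_le (measure_ne_top _ _) (by positivity)).2 hball
  refine le_dimH_of_hausdorffMeasure_ne_zero fun h0 => ?_
  have h1 : μ A = 0 := le_antisymm ((hle A).trans h0.le) zero_le
  have h2 : μ univ ≤ μ A + μ Aᶜ := by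
    rw [← union_compl_self A]
    exact measure_union_le _ _
  rw [h1, hμ, measure_univ] at h2
  simp at h2

/-- At a good scale a maximal `r`-separated set has at most a multiple of `r^(-t)` points. Hausdorff
measure is bounded by a lower limit of covering sums, so arbitrarily small good scales suffice. -/
theorem IsHomogeneousMeasure.dimH_le_of_frequently (hμ : IsHomogeneousMeasure μ A)
    (hA : IsCompact A) (hd : 0 < Metric.diam A) {t : ℝ≥0}
    (h : ∃ᶠ r : ℝ in 𝓝[>] 0, ∃ x ∈ A, r ^ (t : ℝ) ≤ μ.real (Metric.closedBall x r)) :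
    dimH A ≤ t := by
  have := hμ.prob
  obtain ⟨lam, hlam, hcomp⟩ := hμ.exists_real_le_mul hd hA.isBounded
  obtain ⟨K, hK, hdoub⟩ := hμ.doubling hd hA.isBounded (θ := 1 / 2) (by norm_num)
  have hS : ∀ r : ℝ, ∃ S : Finset X, 0 < r → (∀ x ∈ S, x ∈ A) ∧
      (∀ x ∈ S, ∀ y ∈ S, x ≠ y → r < dist x y) ∧ ∀ x ∈ A, ∃ y ∈ S, dist x y ≤ r := by
    intro r
    by_cases hr : 0 < r
    · obtain ⟨S, hS⟩ := exists_finset_separated_cover hA.totallyBounded hr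
      exact ⟨S, fun _ => hS⟩
    · exact ⟨∅, fun h => absurd h hr⟩
  choose S hS using hS
  have hdiam : ∀ (x : X) (r : ℝ),
      Metric.ediam (Metric.closedBall x r) ≤ ENNReal.ofReal (2 * r) := by
    intro x r
    rcases le_or_gt 0 r with hr | hr
    · rw [← Metric.closedEBall_ofReal hr, ENNReal.ofReal_mul (by norm_num)]
      simpa using Metric.ediam_closedEBall_le (x := x) (r := ENNReal.ofReal r)
    · simp [Metric.closedBall_eq_empty.2 hr]
  have hlim : Tendsto (fun r : ℝ => ENNReal.ofReal (2 * r)) (𝓝[>] 0) (𝓝 0) := by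
    have : Tendsto (fun r : ℝ => ENNReal.ofReal (2 * r)) (𝓝 0) (𝓝 (ENNReal.ofReal (2 * 0))) :=
      (ENNReal.continuous_ofReal.comp (continuous_const.mul continuous_id)).tendsto 0
    simp only [mul_zero, ENNReal.ofReal_zero] at this
    exact this.mono_left nhdsWithin_le_nhds
  have hbound := Measure.hausdorffMeasure_le_liminf_sum (t : ℝ) A
    (fun r : ℝ => ENNReal.ofReal (2 * r)) hlim
    (fun (r : ℝ) (i : S r) => Metric.closedBall (i : X) r)
    (Eventually.of_forall fun r i => hdiam _ _)
    (by
      filter_upwards [self_mem_nhdsWithin] with r hr x hx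
      obtain ⟨y, hy, hxy⟩ := (hS r hr).2.2 x hx
      exact mem_iUnion.2 ⟨⟨y, hy⟩, hxy⟩)
  refine dimH_le_of_hausdorffMeasure_ne_top (ne_top_of_le_ne_top
    (ENNReal.ofReal_ne_top (r := 2 ^ (t : ℝ) * (K * lam))) (hbound.trans ?_))
  refine liminf_le_of_frequently_le' ((h.and_eventually self_mem_nhdsWithin).mono ?_)
  rintro r ⟨⟨x, hx, hxr⟩, hr⟩
  have hr : 0 < r := hr
  have h1 := card_mul_real_le hcomp (by linarith) hr (hS r hr).1 (hS r hr).2.1 hx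
  have h2 := hdoub x hx r hr
  rw [show 1 / 2 * r = r / 2 by ring] at h2
  calc ∑ i : S r, Metric.ediam (Metric.closedBall (i : X) r) ^ (t : ℝ)
      ≤ ∑ _i : S r, ENNReal.ofReal ((2 * r) ^ (t : ℝ)) := by
        refine Finset.sum_le_sum fun i _ => ?_
        rw [← ENNReal.ofReal_rpow_of_nonneg (by positivity) t.coe_nonneg]
        exact ENNReal.rpow_le_rpow (hdiam _ _) t.coe_nonneg
    _ = ENNReal.ofReal ((S r).card * (2 * r) ^ (t : ℝ)) := by
        rw [Finset.sum_const, nsmul_eq_mul, Finset.card_univ, Fintype.card_coe,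
          ENNReal.ofReal_mul (Nat.cast_nonneg _), ENNReal.ofReal_natCast]
    _ ≤ _ := by
        refine ENNReal.ofReal_le_ofReal ?_
        rw [Real.mul_rpow (by norm_num) hr.le]
        calc (S r).card * (2 ^ (t : ℝ) * r ^ (t : ℝ))
            = 2 ^ (t : ℝ) * ((S r).card * r ^ (t : ℝ)) := by ring
          _ ≤ 2 ^ (t : ℝ) * ((S r).card * (K * μ.real (Metric.closedBall x (r / 2)))) := by
            gcongr
            exact hxr.trans h2
          _ = 2 ^ (t : ℝ) * (K * ((S r).card * μ.real (Metric.closedBall x (r / 2)))) := by ring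
          _ ≤ _ := by gcongr

/-- For `s > t` each term of a fine packing is at most a constant times the mass of its ball, and
disjoint balls have total mass at most `1`. A packing mixes radii, so all small scales are needed.
-/
theorem IsHomogeneousMeasure.dimP_le_of_eventually (hμ : IsHomogeneousMeasure μ A)
    (hA : IsCompact A) (hd : 0 < Metric.diam A) {t : ℝ≥0}
    (h : ∀ᶠ r : ℝ in 𝓝[>] 0, ∃ x ∈ A, r ^ (t : ℝ) ≤ μ.real (Metric.closedBall x r)) :
    dimP A ≤ t := by
  have := hμ.prob
  obtain ⟨lam, hlam, hcomp⟩ := hμ.exists_real_le_mul hd hA.isBounded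
  refine iSup₂_le fun s hs => ?_
  by_contra! hts
  have hts' : (t : ℝ) ≤ s := by exact_mod_cast (ENNReal.coe_lt_coe.1 hts).le
  obtain ⟨r₀, hr₀, hr₀'⟩ := mem_nhdsGT_iff_exists_Ioo_subset.1 h
  have hr₀pos : 0 < r₀ := hr₀
  refine absurd hs (ne_top_of_le_ne_top (ENNReal.ofReal_ne_top (r := 2 ^ (s : ℝ) * lam))
    ((packingMeasure_le_premeasure s A).trans ?_))
  have hδ : 0 < min 1 (r₀ / 2) := by positivity
  refine iInf₂_le_of_le (min 1 (r₀ / 2)) hδ (iSup₂_le fun P hP => ?_)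
  obtain ⟨hPc, hPA, hPd⟩ := hP
  have := hPc.to_subtype
  have hterm : ∀ p : P, ENNReal.ofReal (2 * (p : X × ℝ).2) ^ (s : ℝ) ≤
      ENNReal.ofReal (2 ^ (s : ℝ) * lam) *
        μ (Metric.closedBall (p : X × ℝ).1 (p : X × ℝ).2) := by
    rintro ⟨⟨x, r⟩, hp⟩
    obtain ⟨hx, hr, hr'⟩ := hPA _ hp
    dsimp only at hx hr hr' ⊢
    have hr1 : r ≤ 1 := hr'.trans (min_le_left _ _)
    have hr2 : r < r₀ := by
      have := hr'.trans (min_le_right _ _)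
      linarith
    obtain ⟨y, hy, hyr⟩ := hr₀' ⟨hr, hr2⟩
    rw [ENNReal.ofReal_rpow_of_nonneg (by positivity) s.coe_nonneg,
      ← ofReal_measureReal (measure_ne_top _ _), ← ENNReal.ofReal_mul (by positivity)]
    refine ENNReal.ofReal_le_ofReal ?_
    rw [Real.mul_rpow (by norm_num) hr.le, mul_assoc]
    gcongr
    calc r ^ (s : ℝ) ≤ r ^ (t : ℝ) := Real.rpow_le_rpow_of_exponent_ge hr hr1 hts'
      _ ≤ _ := hyr.trans (hcomp y hy x hx r hr)
  calc ∑' p : P, ENNReal.ofReal (2 * (p : X × ℝ).2) ^ (s : ℝ)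
      ≤ ∑' p : P, ENNReal.ofReal (2 ^ (s : ℝ) * lam) *
        μ (Metric.closedBall (p : X × ℝ).1 (p : X × ℝ).2) := ENNReal.tsum_le_tsum hterm
    _ = ENNReal.ofReal (2 ^ (s : ℝ) * lam) *
        ∑' p : P, μ (Metric.closedBall (p : X × ℝ).1 (p : X × ℝ).2) := ENNReal.tsum_mul_left
    _ ≤ ENNReal.ofReal (2 ^ (s : ℝ) * lam) * 1 := by
        gcongr
        refine (tsum_meas_le_meas_iUnion_of_disjoint μ
          (fun p => Metric.isClosed_closedBall.measurableSet) ?_).trans prob_le_one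
        intro p q hpq
        exact hPd p.2 q.2 fun he => hpq (Subtype.ext he)
    _ = _ := mul_one _

/-- Finiteness is needed to keep the final inequalities strict in `ℝ≥0∞`. -/
theorem IsHomogeneousMeasure.dimP_lt_top (hμ : IsHomogeneousMeasure μ A)
    (hA : IsCompact A) (hd : 0 < Metric.diam A) : dimP A < ∞ ∧ dimH A < ∞ := by
  obtain ⟨t, C, ht, hall⟩ := hμ.exists_neg_log_le hd hA.isBounded
  obtain ⟨x, hx⟩ : A.Nonempty := by
    rw [nonempty_iff_ne_empty]
    rintro rfl
    simp at hd
  have hev : ∀ᶠ r : ℝ in 𝓝[>] 0,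
      ∃ x ∈ A, r ^ ((⟨t + 1, by positivity⟩ : ℝ≥0) : ℝ) ≤ μ.real (Metric.closedBall x r) := by
    filter_upwards [eventually_nhdsGT_zero_lt hd,
      Real.tendsto_log_nhdsGT_zero.eventually_lt_atBot (-C)] with r hr hlog
    refine ⟨x, hx, ?_⟩
    have h1 := hall x hx r hr.1 hr.2.le
    rw [Real.rpow_def_of_pos hr.1]
    refine (Real.le_log_iff_exp_le (hμ.real_pos hd hx hr.1)).1 ?_
    linarith
  exact ⟨(hμ.dimP_le_of_eventually hA hd hev).trans_lt ENNReal.coe_lt_top,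
    (hμ.dimH_le_of_frequently hA hd hev.frequently).trans_lt ENNReal.coe_lt_top⟩

/-- Comparison of the dimensions of a homogeneous set with those of a homogeneous subset. -/
theorem dim_le_dim_add {ν : Measure X} {F : Set X} (hμ : IsHomogeneousMeasure μ A)
    (hA : IsCompact A) (hd : 0 < Metric.diam A) (hν : IsHomogeneousMeasure ν F)
    (hF : IsCompact F) (hFd : 0 < Metric.diam F) (hFA : F ⊆ A) {η C : ℝ} {r₁ : ℝ} (hη : 0 < η)
    (hr₁ : 0 < r₁)
    (h : ∀ x ∈ F, ∀ r : ℝ, 0 < r → r ≤ r₁ → |Real.log (ν.real (Metric.closedBall x r)) -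
      Real.log (μ.real (Metric.closedBall x r))| ≤ η * |Real.log r| + C) :
    dimH A ≤ dimH F + ENNReal.ofReal (2 * η) ∧ dimP A ≤ dimP F + ENNReal.ofReal (2 * η) := by
  have := hν.prob
  -- One `η` is the stated error; the second absorbs `C`, because `C < η |log r|` for small `r`.
  have key : ∀ s : ℝ≥0, ∀ᶠ r : ℝ in 𝓝[>] 0, ∀ x ∈ F,
      r ^ (s : ℝ) ≤ ν.real (Metric.closedBall x r) →
        r ^ ((s + (2 * η).toNNReal : ℝ≥0) : ℝ) ≤ μ.real (Metric.closedBall x r) := by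
    intro s
    filter_upwards [eventually_nhdsGT_zero_lt (lt_min hr₁ one_pos),
      Real.tendsto_log_nhdsGT_zero.eventually_lt_atBot (-(C / η))] with r hr hlog x hx hxr
    have hr1 : r < r₁ := hr.2.trans_le (min_le_left _ _)
    have hr2 : r < 1 := hr.2.trans_le (min_le_right _ _)
    have h1 := (abs_le.1 (h x hx r hr.1 hr1.le)).2
    rw [abs_of_neg (Real.log_neg hr.1 hr2)] at h1
    rw [Real.rpow_def_of_pos hr.1] at hxr ⊢
    rw [← Real.le_log_iff_exp_le (hν.real_pos hFd hx hr.1)] at hxr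
    rw [← Real.le_log_iff_exp_le (hμ.real_pos hd (hFA hx) hr.1)]
    have h2 : C < η * -Real.log r := by
      rw [← div_lt_iff₀' hη]
      linarith
    rw [NNReal.coe_add, Real.coe_toNNReal _ (by positivity)]
    linarith
  obtain ⟨x₀, hx₀⟩ : F.Nonempty := by
    rw [nonempty_iff_ne_empty]
    rintro rfl
    simp at hFd
  constructor
  · refine ENNReal.le_of_forall_pos_le_add fun e he hlt => ?_
    have hfin : dimH F ≠ ∞ := fun h => by simp [h] at hlt
    lift dimH F to ℝ≥0 using hfin with D hD
    have hnot : ¬ ((D + e : ℝ≥0) : ℝ≥0∞) ≤ dimH F := by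
      rw [← hD, not_le, ENNReal.coe_lt_coe]
      exact lt_add_of_pos_right _ he
    have hfreq : ∃ᶠ r : ℝ in 𝓝[>] 0, ∃ x ∈ F,
        r ^ ((D + e : ℝ≥0) : ℝ) ≤ ν.real (Metric.closedBall x r) := by
      by_contra hcon
      refine hnot (le_dimH_of_eventually hν.supported ?_)
      filter_upwards [not_frequently.1 hcon] with r hr x hx
      by_contra hlt
      exact hr ⟨x, hx, (not_le.1 hlt).le⟩
    have := hμ.dimH_le_of_frequently hA hd ((hfreq.and_eventually (key (D + e))).mono
      fun r ⟨⟨x, hx, hxr⟩, hk⟩ => ⟨x, hFA hx, hk x hx hxr⟩)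
    refine this.trans (le_of_eq ?_)
    rw [ENNReal.ofReal]
    push_cast
    ring
  · refine ENNReal.le_of_forall_pos_le_add fun e he hlt => ?_
    have hfin : dimP F ≠ ∞ := fun h => by simp [h] at hlt
    lift dimP F to ℝ≥0 using hfin with D hD
    -- Half of `e` is kept in reserve: `le_dimP_of_frequently` needs a strict gap between the two
    -- exponents.
    have hnot : ¬ ((D + e / 2 : ℝ≥0) : ℝ≥0∞) ≤ dimP F := by
      rw [← hD, not_le, ENNReal.coe_lt_coe]
      exact lt_add_of_pos_right _ (half_pos he)
    have hlt' : D + e / 2 < D + e := by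
      have := NNReal.half_lt_self he.ne'
      gcongr
    have hev : ∀ᶠ r : ℝ in 𝓝[>] 0, ∀ x ∈ F,
        r ^ ((D + e : ℝ≥0) : ℝ) ≤ ν.real (Metric.closedBall x r) := by
      by_contra hcon
      refine hnot (hν.le_dimP_of_frequently hF hFd hlt' ?_)
      refine (not_eventually.1 hcon).mono fun r hr => ?_
      push Not at hr
      obtain ⟨x, hx, hxr⟩ := hr
      exact ⟨x, hx, hxr.le⟩
    have := hμ.dimP_le_of_eventually hA hd (by
      filter_upwards [hev, key (D + e)] with r h1 h2
      exact ⟨x₀, hFA hx₀, h2 x₀ hx₀ (h1 x₀ hx₀)⟩)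
    refine this.trans (le_of_eq ?_)
    rw [ENNReal.ofReal]
    push_cast
    ring

end Dimension

/-! The classes of `α_A` and the pseudo-distance `χ` -/

theorem AlphaEquiv.trans {f g h : ℝ → ℝ} (hfg : AlphaEquiv f g) (hgh : AlphaEquiv g h) :
    AlphaEquiv f h := by
  have := IsBigO.add hfg hgh
  simpa [AlphaEquiv] using this

theorem tendsto_abs_log_inv : Tendsto (fun r : ℝ => |Real.log r|⁻¹) (𝓝[>] 0) (𝓝 0) :=
  tendsto_inv_atTop_zero.comp (tendsto_abs_atBot_atTop.comp Real.tendsto_log_nhdsGT_zero)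

theorem AlphaEquiv.tendsto {f g : ℝ → ℝ} (h : AlphaEquiv f g) :
    Tendsto (fun r => f r - g r) (𝓝[>] 0) (𝓝 0) :=
  h.trans_tendsto tendsto_abs_log_inv

theorem abs_alphaAt_sub {X Y : Type*} [MetricSpace X] [MeasurableSpace X] [MetricSpace Y]
    [MeasurableSpace Y] (μ : Measure X) (ν : Measure Y) (x : X) (y : Y) (r : ℝ) :
    |alphaAt μ x r - alphaAt ν y r| = |Real.log (μ.real (Metric.closedBall x r)) -
      Real.log (ν.real (Metric.closedBall y r))| * |Real.log r|⁻¹ := by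
  rw [alphaAt, alphaAt, ← sub_div, abs_div, div_eq_mul_inv]

theorem alphaEquiv_of_abs_log_sub_le {X Y : Type*} [MetricSpace X] [MeasurableSpace X]
    [MetricSpace Y] [MeasurableSpace Y] {μ : Measure X} {ν : Measure Y} {x : X} {y : Y} {C r₁ : ℝ}
    (hr₁ : 0 < r₁) (h : ∀ r : ℝ, 0 < r → r ≤ r₁ → |Real.log (μ.real (Metric.closedBall x r)) -
      Real.log (ν.real (Metric.closedBall y r))| ≤ C) :
    AlphaEquiv (alphaAt μ x) (alphaAt ν y) := by
  refine IsBigO.of_bound C ?_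
  filter_upwards [eventually_nhdsGT_zero_lt hr₁] with r hr
  rw [Real.norm_eq_abs, abs_alphaAt_sub, Real.norm_of_nonneg (inv_nonneg.2 (abs_nonneg _))]
  gcongr
  exact h r hr.1 hr.2.le

theorem IsHomogeneousMeasure.alphaEquiv {X : Type*} [MetricSpace X] [MeasurableSpace X]
    [BorelSpace X] {μ ν : Measure X} {A : Set X} (hμ : IsHomogeneousMeasure μ A)
    (hν : IsHomogeneousMeasure ν A) (hd : 0 < Metric.diam A) (hA : IsCompact A) {x y : X}
    (hx : x ∈ A) (hy : y ∈ A) : AlphaEquiv (alphaAt μ x) (alphaAt ν y) := by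
  obtain ⟨C, hC, h⟩ := hμ.exists_real_le_mul_real hν hd hA
  obtain ⟨C', hC', h'⟩ := hν.exists_real_le_mul_real hμ hd hA
  refine alphaEquiv_of_abs_log_sub_le (C := Real.log C + Real.log C') one_pos fun r hr _ => ?_
  have hx0 := hμ.real_pos hd hx hr
  have hy0 := hν.real_pos hd hy hr
  have h1 := Real.log_le_log hx0 (h x hx y hy r hr)
  have h2 := Real.log_le_log hy0 (h' y hy x hx r hr)
  rw [Real.log_mul (by linarith) hy0.ne'] at h1
  rw [Real.log_mul (by linarith) hx0.ne'] at h2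
  have := Real.log_nonneg hC
  have := Real.log_nonneg hC'
  rw [abs_le]
  constructor <;> linarith

/-- One comparison suffices, since all representatives on `A` are already equivalent. Used in both
directions, it gives two codings with the same data the same class, hence the same `χ` to any set.
-/
theorem alphaClass_subset {X Y : Type*} [MetricSpace X] [MeasurableSpace X] [BorelSpace X]
    [MetricSpace Y] [MeasurableSpace Y] {μ : Measure X} {ν : Measure Y} {A : Set X} {B : Set Y}
    (hμ : IsHomogeneousMeasure μ A) (hν : IsHomogeneousMeasure ν B) (hd : 0 < Metric.diam A)
    (hA : IsCompact A) {x : X} {y : Y} (hx : x ∈ A) (hy : y ∈ B)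
    (h : AlphaEquiv (alphaAt μ x) (alphaAt ν y)) : alphaClass A ⊆ alphaClass B := by
  rintro α ⟨μ', hμ', x', hx', hα⟩
  exact ⟨ν, hν, y, hy, hα.trans ((hμ'.alphaEquiv hμ hd hA hx' hx).trans h)⟩

theorem abs_log_le_two_mul {z : ℝ} (hz : |z - 1| ≤ 1 / 2) : |Real.log z| ≤ 2 * |z - 1| := by
  have h0 := abs_le.1 hz
  have hz0 : 1 / 2 ≤ z := by linarith
  have h1 := Real.log_le_sub_one_of_pos (by linarith : 0 < z)
  have h2 := Real.one_sub_inv_le_log_of_pos (by linarith : 0 < z)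
  have h3 : z⁻¹ - 1 ≤ 2 * |z - 1| := by
    have : z⁻¹ - 1 = (1 - z) * z⁻¹ := by
      field_simp
    rw [this]
    have h4 : z⁻¹ ≤ 2 := by
      rw [inv_le_comm₀ (by linarith) (by norm_num)]
      linarith
    have h5 : 0 < z⁻¹ := by positivity
    calc (1 - z) * z⁻¹ ≤ |z - 1| * z⁻¹ := by
          gcongr
          rw [abs_sub_comm]
          exact le_abs_self _
      _ ≤ |z - 1| * 2 := by gcongr
      _ = _ := mul_comm _ _
  have h6 := le_abs_self (z - 1)
  have h7 := abs_nonneg (z - 1)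
  rw [abs_le]
  constructor <;> linarith

/-- For any representatives, `|α - β| ≤ 2η` and `β ≥ t / 2` near `0`, so `α / β` is within `4η / t ≤
1 / 2` of `1` and its logarithm is at most `8η / t ≤ ε`. The constants `c` and `C` vanish after
division by `|log r|`. -/
theorem chi_le {X Y : Type*} [MetricSpace X] [MeasurableSpace X] [BorelSpace X]
    [MetricSpace Y] [MeasurableSpace Y] [BorelSpace Y] {μ : Measure X} {ν : Measure Y} {A : Set X}
    {B : Set Y} (hμ : IsHomogeneousMeasure μ A) (hν : IsHomogeneousMeasure ν B)
    (hAd : 0 < Metric.diam A) (hA : IsCompact A) (hBd : 0 < Metric.diam B) (hB : IsCompact B)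
    {x : X} {y : Y} (hx : x ∈ A) (hy : y ∈ B) {t c η C ε r₁ : ℝ} (ht : 0 < t) (hη : 0 < η)
    (hηt : 8 * η ≤ t) (hηε : 8 * η ≤ ε * t) (hr₁ : 0 < r₁)
    (hgrow : ∀ r : ℝ, 0 < r → r ≤ r₁ →
      t * -Real.log r - c ≤ -Real.log (ν.real (Metric.closedBall y r)))
    (hcomp : ∀ r : ℝ, 0 < r → r ≤ r₁ → |Real.log (μ.real (Metric.closedBall x r)) -
      Real.log (ν.real (Metric.closedBall y r))| ≤ η * |Real.log r| + C) :
    chi A B ≤ ENNReal.ofReal ε := by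
  refine iSup₂_le fun α hα => iSup₂_le fun β hβ => ?_
  obtain ⟨μ', hμ', x', hx', hα⟩ := hα
  obtain ⟨ν', hν', y', hy', hβ⟩ := hβ
  have h1 := (hα.trans (hμ'.alphaEquiv hμ hAd hA hx' hx)).tendsto
  have h2 := (hβ.trans (hν'.alphaEquiv hν hBd hB hy' hy)).tendsto
  have h3 := tendsto_abs_log_inv.const_mul (|C| + |c|)
  rw [mul_zero] at h3
  have hη4 : 0 < η / 4 := by positivity
  rw [Metric.tendsto_nhds] at h1 h2 h3
  refine limsup_le_of_le (by isBoundedDefault) ?_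
  filter_upwards [h1 _ hη4, h2 _ hη4, h3 _ hη4, eventually_nhdsGT_zero_lt (lt_min hr₁ one_pos)]
    with r hr1 hr2 hr3 hr
  refine ENNReal.ofReal_le_ofReal ?_
  have hrr : r < r₁ := hr.2.trans_le (min_le_left _ _)
  have hlog : Real.log r < 0 := Real.log_neg hr.1 (hr.2.trans_le (min_le_right _ _))
  have habs : |Real.log r| = -Real.log r := abs_of_neg hlog
  rw [Real.dist_eq, sub_zero] at hr1 hr2 hr3
  have hinv : 0 < |Real.log r|⁻¹ := by rw [habs]; exact inv_pos.2 (by linarith)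
  have hone : |Real.log r| * |Real.log r|⁻¹ = 1 := mul_inv_cancel₀ (by rw [habs]; linarith)
  have hCc : (|C| + |c|) * |Real.log r|⁻¹ < η / 4 := (le_abs_self _).trans_lt hr3
  have hdiff : |alphaAt μ x r - alphaAt ν y r| ≤ η + η / 4 := by
    rw [abs_alphaAt_sub]
    calc _ ≤ (η * |Real.log r| + C) * |Real.log r|⁻¹ := by
          gcongr
          exact hcomp r hr.1 hrr.le
      _ = η * (|Real.log r| * |Real.log r|⁻¹) + C * |Real.log r|⁻¹ := by ring
      _ ≤ η * 1 + (|C| + |c|) * |Real.log r|⁻¹ := by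
          rw [hone]
          gcongr
          linarith [le_abs_self C, abs_nonneg c]
      _ ≤ _ := by linarith
  have hlow : t - η / 4 ≤ alphaAt ν y r := by
    have h4 := hgrow r hr.1 hrr.le
    have h5 : alphaAt ν y r =
        -Real.log (ν.real (Metric.closedBall y r)) * |Real.log r|⁻¹ := by
      rw [alphaAt, habs, ← neg_inv, div_eq_mul_inv]
      ring
    rw [h5]
    calc t - η / 4 ≤ t * (|Real.log r| * |Real.log r|⁻¹) - (|C| + |c|) * |Real.log r|⁻¹ := by
          rw [hone]; linarith
      _ ≤ t * (|Real.log r| * |Real.log r|⁻¹) - c * |Real.log r|⁻¹ := by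
          gcongr
          linarith [le_abs_self c, abs_nonneg C]
      _ = (t * -Real.log r - c) * |Real.log r|⁻¹ := by rw [habs]; ring
      _ ≤ _ := by gcongr
  have hβ0 : t / 2 ≤ β r := by
    have := (abs_lt.1 hr2).1
    linarith
  have hαβ : |α r - β r| ≤ 2 * η := by
    have e1 := abs_lt.1 hr1
    have e2 := abs_lt.1 hr2
    have e3 := abs_le.1 hdiff
    rw [abs_le]
    constructor <;> linarith [e1.1, e1.2, e2.1, e2.2, e3.1, e3.2]
  have hβpos : 0 < β r := by linarith
  have hz : |α r / β r - 1| ≤ 4 * η / t := by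
    have : α r / β r - 1 = (α r - β r) / β r := by field_simp
    rw [this, abs_div, abs_of_pos hβpos, div_le_div_iff₀ hβpos ht]
    calc |α r - β r| * t ≤ 2 * η * t := by gcongr
      _ = 4 * η * (t / 2) := by ring
      _ ≤ 4 * η * β r := by gcongr
  have hz1 : 4 * η / t ≤ 1 / 2 := by
    rw [div_le_iff₀ ht]; linarith
  have hz2 : 4 * η / t ≤ ε / 2 := by
    rw [div_le_iff₀ ht]; linarith
  have := abs_log_le_two_mul (hz.trans hz1)
  linarith

/-! Approximation by Moran sets -/

theorem IsCoding.abs_log_real_sub_le {Y : Type*} [MetricSpace Y] [MeasurableSpace Y]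
    [BorelSpace Y] {n : ℕ → ℕ} {π : Code n → Y} {b c : ℝ} (h : IsCoding π b c) {N : ℕ}
    (hN : ∀ k, n k ≤ N) (s : Code n) {k : ℕ} {r : ℝ} (hkr : b * c ^ (k + 1) < r)
    (hrk : r ≤ b * c ^ k) :
    |Real.log (((codeMeasure n).map π).real (Metric.closedBall (π s) r)) -
      Real.log (cylMass n k)| ≤ Real.log N := by
  have hN0 : (0 : ℝ) < N := Nat.cast_pos.2 (by have := (h.two_le 0).trans (hN 0); omega)
  have h1 := h.cylMass_le s hkr.le
  have h2 := h.le_cylMass s hrk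
  have h3 := cylMass_le_mul h.two_le hN k
  have h0 := cylMass_pos h.two_le (k + 1)
  have h4 := Real.log_le_log h0 h1
  have h5 := Real.log_le_log (h0.trans_le h1) h2
  have h6 := Real.log_le_log (cylMass_pos h.two_le k) h3
  rw [Real.log_mul hN0.ne' h0.ne'] at h6
  have : 0 ≤ Real.log N := Real.log_natCast_nonneg N
  rw [abs_le]
  constructor <;> linarith

/-- A homogeneous set contains a coded set close to it in Hausdorff distance, whose natural
measure is close to the homogeneous measure. -/
theorem IsHomogeneousMeasure.exists_coding {X : Type*} [MetricSpace X] [MeasurableSpace X]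
    [BorelSpace X] {μ : Measure X} {A : Set X} (h : IsHomogeneousMeasure μ A) (hA : IsCompact A)
    (hd : 0 < Metric.diam A) {ε η : ℝ} (hε : 0 < ε) (hη : 0 < η) :
    ∃ (n : ℕ → ℕ) (N : ℕ) (c R : ℝ) (ch : ℕ → X → ℕ → X) (x₀ : X) (π : Code n → X),
      IsPointTree A n c R ch ∧ c ≤ 1 / 8 ∧ x₀ ∈ A ∧ (∀ k, n k ≤ N) ∧ (∀ s, π s ∈ A) ∧
      (∀ s k, dist (π s) (treePoint ch x₀ (fun j => (s j : ℕ)) k) ≤ R * c ^ k) ∧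
      Metric.hausdorffEDist (range π) A < ENNReal.ofReal ε ∧
      ∃ C : ℝ, ∀ x ∈ A, ∀ k : ℕ, ∀ r : ℝ, 2 * R * c ^ (k + 1) < r → r ≤ 2 * R * c ^ k →
        |Real.log (cylMass n k) - Real.log (μ.real (Metric.closedBall x r))| ≤
          η * |Real.log r| + C := by
  obtain ⟨n, N, c, R, ch, x₀, htree, hc, hx₀, hN, hRc, hcov, hlog⟩ :=
    h.exists_isPointTree hA hd (ε := ε / 4) (by positivity) hη
  obtain ⟨π, hπA, hπ⟩ := htree.exists_limit hA.isComplete hx₀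
  refine ⟨n, N, c, R, ch, x₀, π, htree, hc, hx₀, hN, hπA, hπ, ?_, hlog⟩
  refine lt_of_le_of_lt (Metric.hausdorffEDist_le_of_mem_edist (r := ENNReal.ofReal (ε / 2)) ?_ ?_)
    ((ENNReal.ofReal_lt_ofReal_iff hε).2 (by linarith))
  · rintro _ ⟨s, rfl⟩
    exact ⟨π s, hπA s, by simp⟩
  · intro a ha
    obtain ⟨i, hi, hai⟩ := hcov a ha
    -- Any branch through the first-level node near `a` ends within `R c` of that node.
    let s : Code n := fun k => ⟨if k = 0 then i else 0, by
      split_ifs with hk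
      · exact hk ▸ hi
      · have := htree.two_le k; omega⟩
    refine ⟨π s, mem_range_self s, ?_⟩
    have h1 := hπ s 1
    have h2 : treePoint ch x₀ (fun j => (s j : ℕ)) 1 = ch 0 x₀ i := by simp [treePoint, s]
    rw [h2, pow_one] at h1
    rw [edist_dist]
    refine ENNReal.ofReal_le_ofReal ?_
    have := dist_triangle_right a (π s) (ch 0 x₀ i)
    linarith

theorem IsCoding.exists_abs_log_real_sub_le {X Y : Type*} [MetricSpace X] [MeasurableSpace X]
    [MetricSpace Y] [MeasurableSpace Y] [BorelSpace Y] {n : ℕ → ℕ} {π : Code n → Y} {b c : ℝ}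
    (h : IsCoding π b c) {N : ℕ} (hN : ∀ k, n k ≤ N) {μ : Measure X} {A : Set X} {η C : ℝ}
    (hC : ∀ x ∈ A, ∀ k : ℕ, ∀ r : ℝ, b * c ^ (k + 1) < r → r ≤ b * c ^ k →
      |Real.log (cylMass n k) - Real.log (μ.real (Metric.closedBall x r))| ≤
        η * |Real.log r| + C) (s : Code n) {x : X} (hx : x ∈ A) {r : ℝ} (hr : 0 < r)
    (hrb : r ≤ b) :
    |Real.log (((codeMeasure n).map π).real (Metric.closedBall (π s) r)) -
      Real.log (μ.real (Metric.closedBall x r))| ≤ η * |Real.log r| + (C + Real.log N) := by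
  obtain ⟨k, hk1, hk2⟩ := h.exists_scale hr hrb
  have h1 := h.abs_log_real_sub_le hN s hk1 hk2
  have h2 := hC x hx k r hk1 hk2
  have h3 := abs_sub_le (Real.log (((codeMeasure n).map π).real (Metric.closedBall (π s) r)))
    (Real.log (cylMass n k)) (Real.log (μ.real (Metric.closedBall x r)))
  linarith

theorem IsCoding.alphaEquiv {Y Z : Type*} [MetricSpace Y] [MeasurableSpace Y] [BorelSpace Y]
    [MetricSpace Z] [MeasurableSpace Z] [BorelSpace Z] {n : ℕ → ℕ} {π : Code n → Y}
    {π' : Code n → Z} {b c : ℝ} (h : IsCoding π b c) (h' : IsCoding π' b c) {N : ℕ}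
    (hN : ∀ k, n k ≤ N) (s : Code n) :
    AlphaEquiv (alphaAt ((codeMeasure n).map π) (π s))
      (alphaAt ((codeMeasure n).map π') (π' s)) := by
  refine alphaEquiv_of_abs_log_sub_le (C := Real.log N + Real.log N) h.b_pos fun r hr hrb => ?_
  obtain ⟨k, hk1, hk2⟩ := h.exists_scale hr hrb
  have h1 := h.abs_log_real_sub_le hN s hk1 hk2
  have h2 := h'.abs_log_real_sub_le hN s hk1 hk2
  rw [abs_sub_comm] at h2
  exact (abs_sub_le _ _ _).trans (add_le_add h1 h2)

theorem exists_moranSet_bilipschitz {X : Type*} [MetricSpace X] [MeasurableSpace X] [BorelSpace X]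
    {A : Set X} (hA : IsHomogeneous A) {ε : ℝ} (hε : 0 < ε) :
    ∃ (d : ℕ) (E : Set (EuclideanSpace ℝ (Fin d))) (f : EuclideanSpace ℝ (Fin d) → X),
      IsMoranSet E ∧ MapsTo f E A ∧ IsBilipschitzOn f E ∧
      Metric.hausdorffEDist (f '' E) A < ENNReal.ofReal ε ∧
      IsHomogeneous E ∧ IsHomogeneous (f '' E) ∧
      chi E A = chi (f '' E) A ∧ chi E A < ENNReal.ofReal ε := by
  obtain ⟨hAc, hAd, μ, hμ⟩ := hA
  obtain ⟨t, c₁, ht, hgrow⟩ := hμ.exists_le_neg_log hAd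
  obtain ⟨η, hη, hηt, hηε⟩ : ∃ η : ℝ, 0 < η ∧ 8 * η ≤ t ∧ 8 * η ≤ ε / 2 * t := by
    refine ⟨min (t / 8) (ε / 2 * t / 8), by positivity, ?_, ?_⟩
    · linarith [min_le_left (t / 8) (ε / 2 * t / 8)]
    · linarith [min_le_right (t / 8) (ε / 2 * t / 8)]
  obtain ⟨n, N, c, R, ch, x₀, π, htree, hc, hx₀, hN, hπA, hπ, hdist, C, hC⟩ :=
    hμ.exists_coding hAc hAd hε hη
  obtain ⟨ch', htree'⟩ := exists_isPointTree_euclidean htree.two_le hN htree.c_pos hc htree.R_pos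
  obtain ⟨π', -, hπ'⟩ := htree'.exists_limit isComplete_univ (mem_univ 0)
  have hcod := htree.isCoding hx₀ hπ
  have hcod' := htree'.isCoding (mem_univ 0) hπ'
  -- The map is `π ∘ π'⁻¹` on the Euclidean set; its value `x₀` elsewhere plays no role.
  have hfπ : ∀ s, Function.extend π' π (fun _ => x₀) (π' s) = π s :=
    hcod'.injective.extend_apply π _
  have himage : Function.extend π' π (fun _ => x₀) '' range π' = range π := by
    rw [← range_comp]
    exact congrArg range (funext hfπ)
  have hμE := hcod'.isHomogeneousMeasure hN
  have hμF := hcod.isHomogeneousMeasure hN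
  let s₀ : Code n := fun k => ⟨0, by have := htree.two_le k; omega⟩
  have hclass : alphaClass (range π') = alphaClass (range π) :=
    (alphaClass_subset hμE hμF hcod'.diam_pos hcod'.isCompact_range (mem_range_self s₀)
      (mem_range_self s₀) (hcod'.alphaEquiv hcod hN s₀)).antisymm
    (alphaClass_subset hμF hμE hcod.diam_pos hcod.isCompact_range (mem_range_self s₀)
      (mem_range_self s₀) (hcod.alphaEquiv hcod' hN s₀))
  refine ⟨N, range π', Function.extend π' π fun _ => x₀, htree'.isMoranSet (mem_univ 0) hπ', ?_,
    ⟨c⁻¹, (one_le_inv₀ htree.c_pos).2 (by linarith), ?_⟩, ?_, hcod'.isHomogeneous hN, ?_, ?_, ?_⟩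
  · rintro _ ⟨s, rfl⟩
    rw [hfπ]
    exact hπA s
  · rintro _ ⟨s, rfl⟩ _ ⟨u, rfl⟩
    rw [hfπ, hfπ]
    refine ⟨?_, hcod.dist_le_mul hcod' s u⟩
    rw [div_le_iff₀ (inv_pos.2 htree.c_pos), mul_comm]
    exact hcod'.dist_le_mul hcod s u
  · rwa [himage]
  · rw [himage]
    exact hcod.isHomogeneous hN
  · rw [himage, chi, chi, hclass]
  · refine lt_of_le_of_lt (chi_le (ε := ε / 2) (c := c₁) (C := C + Real.log N)
      (r₁ := min (Metric.diam A) (2 * R)) hμE hμ hcod'.diam_pos hcod'.isCompact_range hAd hAc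
      (mem_range_self s₀) hx₀ ht hη hηt hηε (lt_min hAd hcod.b_pos)
      (fun r hr hr1 => hgrow x₀ hx₀ r hr (hr1.trans (min_le_left _ _)))
      (fun r hr hr1 => hcod'.exists_abs_log_real_sub_le hN hC s₀ hx₀ hr
        (hr1.trans (min_le_right _ _)))) ?_
    exact (ENNReal.ofReal_lt_ofReal_iff hε).2 (by linarith)

theorem exists_moranSet_subset {d : ℕ} {A : Set (EuclideanSpace ℝ (Fin d))}
    (hA : IsHomogeneous A) {ε : ℝ} (hε : 0 < ε) :
    ∃ F : Set (EuclideanSpace ℝ (Fin d)),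
      IsMoranSet F ∧ F ⊆ A ∧ Metric.hausdorffEDist F A < ENNReal.ofReal ε ∧
      dimP F ≤ dimP A ∧ dimP A < dimP F + ENNReal.ofReal ε ∧
      dimH F ≤ dimH A ∧ dimH A < dimH F + ENNReal.ofReal ε := by
  obtain ⟨hAc, hAd, μ, hμ⟩ := hA
  -- The dimensions drop by at most `2η`, so `η = ε / 4` leaves room for a strict inequality.
  obtain ⟨n, N, c, R, ch, x₀, π, htree, hc, hx₀, hN, hπA, hπ, hdist, C, hC⟩ :=
    hμ.exists_coding hAc hAd hε (η := ε / 4) (by positivity)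
  have hcod := htree.isCoding hx₀ hπ
  have hFA : range π ⊆ A := range_subset_iff.2 hπA
  obtain ⟨hP, hH⟩ := hμ.dimP_lt_top hAc hAd
  obtain ⟨h1, h2⟩ := dim_le_dim_add (η := ε / 4) (C := C + Real.log N) (r₁ := 2 * R) hμ hAc hAd
    (hcod.isHomogeneousMeasure hN) hcod.isCompact_range hcod.diam_pos hFA (by positivity)
    hcod.b_pos (by
      rintro _ ⟨s, rfl⟩ r hr hrb
      exact hcod.exists_abs_log_real_sub_le hN hC s (hπA s) hr hrb)
  have hlt : ENNReal.ofReal (2 * (ε / 4)) < ENNReal.ofReal ε :=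
    (ENNReal.ofReal_lt_ofReal_iff hε).2 (by linarith)
  exact ⟨range π, htree.isMoranSet hx₀ hπ, hFA, hdist, dimP_mono hFA,
    h2.trans_lt (ENNReal.add_lt_add_left ((dimP_mono hFA).trans_lt hP).ne hlt), dimH_mono hFA,
    h1.trans_lt (ENNReal.add_lt_add_left ((dimH_mono hFA).trans_lt hH).ne hlt)⟩

end HomogeneousFractal

end

theorem theorem1p5 :
    (∀ (X : Type*) [MetricSpace X] [MeasurableSpace X] [BorelSpace X] (A : Set X),
      HomogeneousFractal.IsHomogeneous A → ∀ ε : ℝ, 0 < ε →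
        ∃ (d : ℕ) (E : Set (EuclideanSpace ℝ (Fin d))) (f : EuclideanSpace ℝ (Fin d) → X),
          HomogeneousFractal.IsMoranSet E ∧ MapsTo f E A ∧
          HomogeneousFractal.IsBilipschitzOn f E ∧
          Metric.hausdorffEDist (f '' E) A < ENNReal.ofReal ε ∧
          HomogeneousFractal.IsHomogeneous E ∧ HomogeneousFractal.IsHomogeneous (f '' E) ∧
          HomogeneousFractal.chi E A = HomogeneousFractal.chi (f '' E) A ∧
          HomogeneousFractal.chi E A < ENNReal.ofReal ε) ∧
    (∀ (d : ℕ) (A : Set (EuclideanSpace ℝ (Fin d))),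
      HomogeneousFractal.IsHomogeneous A → ∀ ε : ℝ, 0 < ε →
        ∃ F : Set (EuclideanSpace ℝ (Fin d)),
          HomogeneousFractal.IsMoranSet F ∧ F ⊆ A ∧
          Metric.hausdorffEDist F A < ENNReal.ofReal ε ∧
          HomogeneousFractal.dimP F ≤ HomogeneousFractal.dimP A ∧
          HomogeneousFractal.dimP A < HomogeneousFractal.dimP F + ENNReal.ofReal ε ∧
          dimH F ≤ dimH A ∧ dimH A < dimH F + ENNReal.ofReal ε) := by
  refine ⟨?_, ?_⟩
  · intro X _ _ _ A hA ε hε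
    exact HomogeneousFractal.exists_moranSet_bilipschitz hA hε
  · intro d A hA ε hε
    exact HomogeneousFractal.exists_moranSet_subset hA hε
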